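/- Let $\varepsilon,m>0$. **Feynman's checker amplitudes.** A checker path $s$ is a finite sequence of points of $\varepsilon\mathbb{Z}^2$ such that the vector from each point (except the last one) to the next one is $(\varepsilon,\varepsilon)$ or $(-\varepsilon,\varepsilon)$. Let $\mathrm{turns}(s)$ be the number of points of $s$ (neither first nor last) at which the vectors to the next and to the previous point are orthogonal, and put $a(s):=(1+m^2\varepsilon^2)^{1-n/2}\,i\,(-im\varepsilon)^{\mathrm{turns}(s)}$, where $n$ is the number of points in $s$. For $(x,t)\in\varepsilon\mathbb{Z}^2$ with $t>0$ let $a(x,t):=\sum_s a(s)$ be the sum over all checker paths $s$ from $(0,0)$ to $(x,t)$ containing $(\varepsilon,\varepsilon)$ (an empty sum is $0$), and let $a_1(x,t):=\mathrm{Re}\,a(x,t)$, $a_2(x,t):=\mathrm{Im}\,a(x,t)$. **Axioms.** For $0<\delta<1$, consider pairs of complex-valued functions $A_1,A_2$ on the doubled lattice $\{(x,t)\in\mathbb{R}^2: 2x/\varepsilon,\,2t/\varepsilon,\,(x+t)/\varepsilon\in\mathbb{Z}\}$ satisfying the following three conditions. 1. For each $(x,t)$ with $2x/\varepsilon$ and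 $2t/\varepsilon$ even, $$A_1(x,t)=\tfrac{1}{\sqrt{1+m^2\varepsilon^2}}\left(A_1(x+\tfrac{\varepsilon}{2},t-\tfrac{\varepsilon}{2})+m\varepsilon A_2(x+\tfrac{\varepsilon}{2},t-\tfrac{\varepsilon}{2})\right),$$ $$A_2(x,t)=\tfrac{1}{\sqrt{1+m^2\varepsilon^2}}\left(A_2(x-\tfrac{\varepsilon}{2},t-\tfrac{\varepsilon}{2})-m\varepsilon A_1(x-\tfrac{\varepsilon}{2},t-\tfrac{\varepsilon}{2})\right)+2\delta_{x0}\delta_{t0},$$ where $\delta_{x0}$ and $\delta_{t0}$ are Kronecker deltas. 2. For each $(x,t)$ with $2x/\varepsilon$ and $2t/\varepsilon$ odd, $$A_1(x,t)=\tfrac{1}{\sqrt{1-\delta^2}}\left(A_1(x+\tfrac{\varepsilon}{2},t-\tfrac{\varepsilon}{2})-i\delta A_2(x+\tfrac{\varepsilon}{2},t-\tfrac{\varepsilon}{2})\right),$$ $$A_2(x,t)=\tfrac{1}{\sqrt{1-\delta^2}}\left(A_2(x-\tfrac{\varepsilon}{2},t-\tfrac{\varepsilon}{2})+i\delta A_1(x-\tfrac{\varepsilon}{2},t-\tfrac{\varepsilon}{2})\right).$$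 3. $\sum_{(x,t)\in\varepsilon\mathbb{Z}^2}\left(|A_1(x,t)|^2+|A_2(x,t)|^2\right)<\infty$. **Theorem.** For each $\delta\in(0,1)$ there exists a unique pair of functions $A_k(x,t)=A_k(x,t,\delta)$, $k\in\{1,2\}$, on the doubled lattice satisfying conditions 1–3. For each $(x,t)\in\varepsilon\mathbb{Z}^2$ and $k\in\{1,2\}$ the limit $\widetilde{A}_k(x,t):=\lim_{\delta\searrow0}A_k(x,t,\delta)$ exists. For $(x+t)/\varepsilon+k$ even the limit is real and given by $$\widetilde{A}_1(x,t)=a_1(x,|t|+\varepsilon)\quad\text{for }(x+t)/\varepsilon\text{ odd},$$ $$\widetilde{A}_2(x,t)=\pm a_2(\pm x+\varepsilon,|t|+\varepsilon)\quad\text{for }(x+t)/\varepsilon\text{ even},$$ where both minus signs are taken when $t<0$ and both plus signs when $t\ge 0$. For $(x+t)/\varepsilon+k$ odd, the limit is purely imaginary (that is, its real part is zero). -/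

import Mathlib

open Filter Topology

noncomputable section

/-- The lattice `εℤ²`. -/
def squareLattice (ε : ℝ) : Set (ℝ × ℝ) :=
  {p | (∃ a : ℤ, p.1 / ε = a) ∧ ∃ b : ℤ, p.2 / ε = b}

/-- The doubled lattice: the union of `εℤ²` and of the dual lattice `(ε/2, ε/2) + εℤ²`. -/
def doubledLattice (ε : ℝ) : Set (ℝ × ℝ) :=
  {p | (∃ a : ℤ, 2 * p.1 / ε = a) ∧ (∃ b : ℤ, 2 * p.2 / ε = b) ∧ ∃ c : ℤ, (p.1 + p.2) / ε = c}

theorem squareLattice_subset_doubledLattice (ε : ℝ) : squareLattice ε ⊆ doubledLattice ε := by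
  rintro p ⟨⟨a, ha⟩, b, hb⟩
  refine ⟨⟨2 * a, ?_⟩, ⟨2 * b, ?_⟩, a + b, ?_⟩
  · push_cast; rw [← ha]; ring
  · push_cast; rw [← hb]; ring
  · push_cast; rw [← ha, ← hb]; ring

theorem exists_int_eq_div_self (ε : ℝ) : ∃ k : ℤ, ε / ε = k := by
  by_cases h : ε = 0
  · exact ⟨0, by simp [h]⟩
  · exact ⟨1, by simp [h]⟩

/-- A point of `εℤ²` as a point of the doubled lattice. -/
def latticeIncl {ε : ℝ} (P : squareLattice ε) : doubledLattice ε :=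
  ⟨P.1, squareLattice_subset_doubledLattice ε P.2⟩

/-- The point `(x + ε/2, t - ε/2)`. -/
def rightDown {ε : ℝ} (P : doubledLattice ε) : doubledLattice ε :=
  ⟨(P.1.1 + ε / 2, P.1.2 - ε / 2), by
    obtain ⟨⟨x, t⟩, ⟨a, ha⟩, ⟨b, hb⟩, c, hc⟩ := P
    obtain ⟨k, hk⟩ := exists_int_eq_div_self ε
    refine ⟨⟨a + k, ?_⟩, ⟨b - k, ?_⟩, c, ?_⟩
    · push_cast; rw [← ha, ← hk]; ring
    · push_cast; rw [← hb, ← hk]; ring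
    · rw [← hc]; ring⟩

/-- The point `(x - ε/2, t - ε/2)`. -/
def leftDown {ε : ℝ} (P : doubledLattice ε) : doubledLattice ε :=
  ⟨(P.1.1 - ε / 2, P.1.2 - ε / 2), by
    obtain ⟨⟨x, t⟩, ⟨a, ha⟩, ⟨b, hb⟩, c, hc⟩ := P
    obtain ⟨k, hk⟩ := exists_int_eq_div_self ε
    refine ⟨⟨a - k, ?_⟩, ⟨b - k, ?_⟩, c - k, ?_⟩
    · push_cast; rw [← ha, ← hk]; ring
    · push_cast; rw [← hb, ← hk]; ring
    · push_cast; rw [← hc, ← hk]; ring⟩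

/-- `2x/ε` and `2t/ε` are even integers. -/
def IsEvenPoint (ε : ℝ) (p : ℝ × ℝ) : Prop :=
  (∃ a : ℤ, Even a ∧ 2 * p.1 / ε = a) ∧ ∃ b : ℤ, Even b ∧ 2 * p.2 / ε = b

/-- `2x/ε` and `2t/ε` are odd integers. -/
def IsOddPoint (ε : ℝ) (p : ℝ × ℝ) : Prop :=
  (∃ a : ℤ, Odd a ∧ 2 * p.1 / ε = a) ∧ ∃ b : ℤ, Odd b ∧ 2 * p.2 / ε = b

/-- Axioms 1, 2, 3 for a pair of functions `A₁, A₂` on the doubled lattice, where `ε` is the lattice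
step, `m` the particle mass, `δ` the small imaginary mass. -/
structure SatisfiesAxioms (ε m δ : ℝ) (A₁ A₂ : doubledLattice ε → ℂ) : Prop where
  axiom1_fst : ∀ P : doubledLattice ε, IsEvenPoint ε P.1 →
    A₁ P = (1 / √(1 + m ^ 2 * ε ^ 2) : ℝ) *
      (A₁ (rightDown P) + m * ε * A₂ (rightDown P))
  axiom1_snd : ∀ P : doubledLattice ε, IsEvenPoint ε P.1 →
    A₂ P = (1 / √(1 + m ^ 2 * ε ^ 2) : ℝ) *
      (A₂ (leftDown P) - m * ε * A₁ (leftDown P)) + (if P.1 = (0, 0) then 2 else 0)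
  axiom2_fst : ∀ P : doubledLattice ε, IsOddPoint ε P.1 →
    A₁ P = (1 / √(1 - δ ^ 2) : ℝ) *
      (A₁ (rightDown P) - Complex.I * δ * A₂ (rightDown P))
  axiom2_snd : ∀ P : doubledLattice ε, IsOddPoint ε P.1 →
    A₂ P = (1 / √(1 - δ ^ 2) : ℝ) *
      (A₂ (leftDown P) + Complex.I * δ * A₁ (leftDown P))
  axiom3 : Summable fun P : squareLattice ε =>
    ‖A₁ (latticeIncl P)‖ ^ 2 + ‖A₂ (latticeIncl P)‖ ^ 2

/-- A checker path: a finite sequence of points of `εℤ²` in which every step is `(ε, ε)` or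
`(-ε, ε)`. -/
def IsCheckerPath (ε : ℝ) (s : List (ℝ × ℝ)) : Prop :=
  (∀ p ∈ s, p ∈ squareLattice ε) ∧
    s.IsChain fun p q => q - p = (ε, ε) ∨ q - p = (-ε, ε)

/-- The number of points of a path, other than the first and the last one, such that the vectors
from the point to the next and to the previous ones are orthogonal. -/
def turns : List (ℝ × ℝ) → ℕ
  | p :: q :: r :: s =>
    (if (r - q).1 * (p - q).1 + (r - q).2 * (p - q).2 = 0 then 1 else 0) + turns (q :: r :: s)
  | _ => 0

/-- The complex number `a(s)` assigned to a path `s`. -/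
def pathWeight (m ε : ℝ) (s : List (ℝ × ℝ)) : ℂ :=
  ((1 + m ^ 2 * ε ^ 2) ^ (1 - (s.length : ℝ) / 2) : ℝ) * Complex.I *
    (-Complex.I * m * ε) ^ turns s

/-- The checker paths from `(0, 0)` to `(x, t)` containing `(ε, ε)`. -/
def checkerPaths (x t ε : ℝ) : Set (List (ℝ × ℝ)) :=
  {s | IsCheckerPath ε s ∧ s.head? = some (0, 0) ∧ s.getLast? = some (x, t) ∧ (ε, ε) ∈ s}

/-- The sum `a(x, t, m, ε)` over checker paths. For `ε > 0` there are only finitely many of them. -/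
def checkerAmplitude (x t m ε : ℝ) : ℂ :=
  ∑ᶠ s ∈ checkerPaths x t ε, pathWeight m ε s

def checkerAmplitude₁ (x t m ε : ℝ) : ℝ := (checkerAmplitude x t m ε).re

def checkerAmplitude₂ (x t m ε : ℝ) : ℝ := (checkerAmplitude x t m ε).im

end

/-!
Put `μ = m * ε` and let `κ` be the product of the two normalization factors. In the integer
coordinates `X = x / ε`, `T = t / ε` the second axiom expresses the values at odd points through the
values on `εℤ²`, so that the axioms become a one-step evolution in `T` for functions on `ℤ × ℤ`, with
a source at the origin and a summability condition (`IsPropagator`). As a function of the momentum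
the evolution is a `2 × 2` matrix of determinant one and of trace `2 * z`, where
`z = κ * (cos p + i * μ * δ)`; hence its eigenvalues are `z ± i * s` with `s ^ 2 = 1 - z ^ 2`.

*Uniqueness* (`IsPropagator.unique`). By the Cayley–Hamilton theorem each component of a solution of
the homogeneous equation satisfies the lattice Klein–Gordon equation
`u(X, T + 1) + u(X, T - 1) = κ * (u(X + 1, T) + u(X - 1, T) + 2 * i * μ * δ * u(X, T))`. Pairing it
with the square-summable `u` and taking the imaginary part gives `∑ ‖u‖ ^ 2 = 0`.

*Existence* (`isPropagator_coeffFunctional_symbol`). Since `Im z > 0`, the eigenvalue `z - i * s` lies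
strictly inside the unit disc for each momentum, by compactness uniformly. The stable part of the
source evolves forward and the unstable part backward in time; both decay exponentially, and
Parseval's identity gives the summability condition.

*The limit*. At time zero the solution is a combination of the Fourier coefficients of `1 / s`, to
which dominated convergence applies (`continuousAt_invSinCoeff`). In the limit `s` becomes
`√(1 - c ^ 2 * cos p ^ 2)` with `c = 1 / √(1 + μ ^ 2)`, hence the coefficients are real, and those with
odd indices vanish by the translation of `p` by half a period. The limiting evolution is real and
decouples two sublattices. On one of them (`X + T + k` even) the data at time zero are those of the
free retarded evolution, and the solution is the path sum; on the other one the data are purely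
imaginary, and so they remain (`tendsto_propagator_natCast`). For negative times the evolution is
inverted; this reflects space and changes the sign of the second component
(`tendsto_propagator_neg_natCast`).

*Paths* (`checkerAmplitude_eq`). A path is encoded by the list of the directions of its steps.
Removing the last step gives the same evolution for the sums over paths with a given last step.
-/

noncomputable section

open MeasureTheory AddCircle

/-! ### The symbol of the evolution in momentum space -/

/-- The cosine of the momentum `p`, the latter being a point of the circle of length one. -/
def momentumCos (p : UnitAddCircle) : ℝ := (fourier 1 p).re

/-- Half of the trace of the one-step evolution in momentum space. Here `κ` is the product of the
two normalization factors and `η` is the product of the real and of the imaginary mass. -/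
def halfTrace (κ η : ℝ) (p : UnitAddCircle) : ℂ := κ * (momentumCos p + Complex.I * η)

/-- The principal square root of `1 - z ^ 2`, where `z` is `halfTrace`: for real `z = cos ω` this
is the sine of the frequency `ω`. -/
def freqSin (κ η : ℝ) (p : UnitAddCircle) : ℂ := (1 - halfTrace κ η p ^ 2) ^ (2⁻¹ : ℂ)

theorem continuous_momentumCos : Continuous momentumCos := by
  unfold momentumCos; fun_prop

theorem abs_momentumCos_le_one (p : UnitAddCircle) : |momentumCos p| ≤ 1 := by
  refine (Complex.abs_re_le_norm _).trans ?_
  rw [fourier_apply, Circle.norm_coe]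

theorem fourier_neg_one_add_fourier_one (p : UnitAddCircle) :
    fourier (-1) p + fourier 1 p = (2 * momentumCos p : ℂ) := by
  rw [fourier_neg, momentumCos, add_comm, Complex.add_conj]
  push_cast; ring

theorem fourier_neg_one_mul_fourier_one (p : UnitAddCircle) :
    fourier (-1) p * fourier 1 p = 1 := by
  rw [← fourier_add]; simp

theorem continuous_halfTrace (κ η : ℝ) : Continuous (halfTrace κ η) := by
  have := continuous_momentumCos
  unfold halfTrace; fun_prop

theorem one_sub_halfTrace_sq_re (κ η : ℝ) (p : UnitAddCircle) :
    (1 - halfTrace κ η p ^ 2).re = 1 - κ ^ 2 * momentumCos p ^ 2 + κ ^ 2 * η ^ 2 := by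
  simp [halfTrace, pow_two]; ring

theorem one_sub_halfTrace_sq_im (κ η : ℝ) (p : UnitAddCircle) :
    (1 - halfTrace κ η p ^ 2).im = -2 * κ ^ 2 * η * momentumCos p := by
  simp [halfTrace, pow_two]; ring

theorem one_sub_sq_le_re (κ η : ℝ) (p : UnitAddCircle) :
    1 - κ ^ 2 ≤ (1 - halfTrace κ η p ^ 2).re := by
  rw [one_sub_halfTrace_sq_re]
  have h : momentumCos p ^ 2 ≤ 1 := (sq_le_one_iff_abs_le_one _).2 (abs_momentumCos_le_one p)
  nlinarith [sq_nonneg κ, sq_nonneg (κ * η)]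

theorem one_sub_halfTrace_sq_mem_slitPlane {κ η : ℝ} (h : (0 < κ ∧ 0 < η) ∨ κ ^ 2 < 1)
    (p : UnitAddCircle) : 1 - halfTrace κ η p ^ 2 ∈ Complex.slitPlane := by
  rcases h with ⟨hκ, hη⟩ | h
  · rw [Complex.mem_slitPlane_iff, one_sub_halfTrace_sq_re, one_sub_halfTrace_sq_im]
    by_cases hp : momentumCos p = 0
    · left
      rw [hp]
      nlinarith [sq_nonneg (κ * η)]
    · right
      exact mul_ne_zero (mul_ne_zero (mul_ne_zero (by norm_num) (by positivity)) hη.ne') hp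
  · left; linarith [one_sub_sq_le_re κ η p]

theorem freqSin_sq (κ η : ℝ) (p : UnitAddCircle) :
    freqSin κ η p ^ 2 = 1 - halfTrace κ η p ^ 2 := by
  have := Complex.cpow_nat_inv_pow (1 - halfTrace κ η p ^ 2) (n := 2) two_ne_zero
  rw [freqSin]
  exact_mod_cast this

theorem freqSin_ne_zero {κ η : ℝ} (h : (0 < κ ∧ 0 < η) ∨ κ ^ 2 < 1) (p : UnitAddCircle) :
    freqSin κ η p ≠ 0 := by
  intro h0
  have := freqSin_sq κ η p
  rw [h0] at this
  exact Complex.slitPlane_ne_zero (one_sub_halfTrace_sq_mem_slitPlane h p) (by rw [← this]; simp)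

theorem freqSin_re_pos {κ η : ℝ} (h : (0 < κ ∧ 0 < η) ∨ κ ^ 2 < 1) (p : UnitAddCircle) :
    0 < (freqSin κ η p).re := by
  have hs := one_sub_halfTrace_sq_mem_slitPlane h p
  rw [freqSin, Complex.cpow_inv_two_re, Real.sqrt_pos]
  set a := 1 - halfTrace κ η p ^ 2
  have h1 := Complex.abs_re_le_norm a
  rcases Complex.mem_slitPlane_iff.1 hs with h2 | h2
  · positivity
  · have := Complex.abs_re_lt_norm.2 h2
    linarith [neg_abs_le a.re]

theorem continuous_freqSin {κ η : ℝ} (h : (0 < κ ∧ 0 < η) ∨ κ ^ 2 < 1) :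
    Continuous (freqSin κ η) :=
  ((continuous_halfTrace κ η).pow 2 |> continuous_const.sub).cpow continuous_const
    (one_sub_halfTrace_sq_mem_slitPlane h)

/-- The eigenvalue `z - i s` of the one-step evolution lies inside the unit disc. Indeed,
`‖z + i s‖ ^ 2 - ‖z - i s‖ ^ 2` is a positive multiple of `Im (z * conj s)`, which is positive, and
the product of `z + i s` and `z - i s` is one. -/
theorem norm_halfTrace_sub_lt_one {κ η : ℝ} (hκ : 0 < κ) (hη : 0 < η) (p : UnitAddCircle) :
    ‖halfTrace κ η p - Complex.I * freqSin κ η p‖ < 1 := by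
  have hs := freqSin_sq κ η p
  have hu := freqSin_re_pos (.inl ⟨hκ, hη⟩ : (0 < κ ∧ 0 < η) ∨ κ ^ 2 < 1) p
  have hy : 0 < (halfTrace κ η p).im := by simp [halfTrace]; positivity
  generalize halfTrace κ η p = z at *
  generalize freqSin κ η p = s at *
  have hprod : ‖z - Complex.I * s‖ * ‖z + Complex.I * s‖ = 1 := by
    rw [← norm_mul]
    have : (z - Complex.I * s) * (z + Complex.I * s) = 1 := by
      linear_combination -s ^ 2 * Complex.I_sq + hs
    rw [this, norm_one]
  have him : s.re * s.im = -(z.re * z.im) := by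
    have := congrArg Complex.im hs
    simp [pow_two] at this
    linarith
  have hpos : 0 < z.im * s.re - z.re * s.im := by
    have : 0 < (z.im * s.re - z.re * s.im) * s.re := by
      have h2 : (z.im * s.re - z.re * s.im) * s.re = z.im * (s.re ^ 2 + z.re ^ 2) := by
        linear_combination (-z.re) * him
      rw [h2]; positivity
    exact pos_of_mul_pos_left this hu.le
  have hlt : ‖z - Complex.I * s‖ ^ 2 < ‖z + Complex.I * s‖ ^ 2 := by
    rw [← Complex.normSq_eq_norm_sq, ← Complex.normSq_eq_norm_sq, Complex.normSq_apply,
      Complex.normSq_apply]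
    simp
    nlinarith
  have hlt' := lt_of_pow_lt_pow_left₀ 2 (norm_nonneg _) hlt
  by_contra! hge
  nlinarith

/-! ### The propagator in momentum space -/

section Symbol

variable {κ η : ℝ}

/-- The pointwise inverse of `freqSin`, as a continuous function. -/
def freqSinInv (κ η : ℝ) (h : (0 < κ ∧ 0 < η) ∨ κ ^ 2 < 1) : C(UnitAddCircle, ℂ) :=
  ⟨fun p => (freqSin κ η p)⁻¹, (continuous_freqSin h).inv₀ (freqSin_ne_zero h)⟩

/-- The eigenvalue of the one-step evolution lying inside the unit disc. -/
def smallEigenvalue (κ η : ℝ) (h : (0 < κ ∧ 0 < η) ∨ κ ^ 2 < 1) : C(UnitAddCircle, ℂ) :=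
  ⟨fun p => halfTrace κ η p - Complex.I * freqSin κ η p,
    (continuous_halfTrace κ η).sub (continuous_const.mul (continuous_freqSin h))⟩

theorem norm_smallEigenvalue_lt_one (hκ : 0 < κ) (hη : 0 < η) :
    ‖smallEigenvalue κ η (.inl ⟨hκ, hη⟩)‖ < 1 :=
  (ContinuousMap.norm_lt_iff _ one_pos).2 (norm_halfTrace_sub_lt_one hκ hη)

end Symbol

/-- The first component of the propagator in momentum space at time `T`. Together with `symbolSnd`
it is a solution of the momentum-space evolution that decays in both directions of time, with the
source at time zero. The character `fourier (-1)` corresponds to the shift `X ↦ X + 1`. -/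
def symbolFst (κ μ δ : ℝ) (h : (0 < κ ∧ 0 < μ * δ) ∨ κ ^ 2 < 1) (T : ℤ) : C(UnitAddCircle, ℂ) :=
  (Complex.I * κ) • ((μ : ℂ) • 1 - (Complex.I * δ) • fourier (-1)) * freqSinInv κ (μ * δ) h *
    smallEigenvalue κ (μ * δ) h ^ T.natAbs

/-- The second component of the propagator in momentum space at time `T`. -/
def symbolSnd (κ μ δ : ℝ) (h : (0 < κ ∧ 0 < μ * δ) ∨ κ ^ 2 < 1) (T : ℤ) : C(UnitAddCircle, ℂ) :=
  ((if 0 ≤ T then 1 else -1 : ℂ) • 1 +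
    (Complex.I * κ / 2) • (fourier 1 - fourier (-1)) * freqSinInv κ (μ * δ) h) *
    smallEigenvalue κ (μ * δ) h ^ T.natAbs

/-- The equations behind `symbol_recursion`, with `w`, `v` standing for the two
characters, `r` for the inverse of the sine and `l` for the small eigenvalue: the vector with the
components `iκ(μ - iδw)r` and `σ + iκ(v - w)r/2` is an eigenvector of the evolution, with the
eigenvalue `l` for `σ = 1` and with the eigenvalue `l⁻¹` for `σ = -1`. -/
theorem symbol_eigenvector {κ μ δ : ℝ} (hκ : κ ^ 2 * (1 + μ ^ 2) * (1 - δ ^ 2) = 1)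
    {w v s r z l : ℂ} (hwv : w * v = 1) (hz : z = κ * ((w + v) / 2 + Complex.I * (μ * δ)))
    (hs : s ^ 2 = 1 - z ^ 2) (hr : r * s = 1) (hl : l = z - Complex.I * s) :
    (l * (Complex.I * κ * (μ - Complex.I * δ * w) * r) =
      κ * ((w + Complex.I * (μ * δ)) * (Complex.I * κ * (μ - Complex.I * δ * w) * r) +
        (μ - Complex.I * δ * w) * (1 + Complex.I * κ / 2 * (v - w) * r))) ∧
    (l * (1 + Complex.I * κ / 2 * (v - w) * r) =
      κ * ((v + Complex.I * (μ * δ)) * (1 + Complex.I * κ / 2 * (v - w) * r) +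
        (Complex.I * δ * v - μ) * (Complex.I * κ * (μ - Complex.I * δ * w) * r))) ∧
    (Complex.I * κ * (μ - Complex.I * δ * w) * r =
      κ * ((w + Complex.I * (μ * δ)) * (Complex.I * κ * (μ - Complex.I * δ * w) * r) +
        (μ - Complex.I * δ * w) * (-1 + Complex.I * κ / 2 * (v - w) * r)) * l) ∧
    (-1 + Complex.I * κ / 2 * (v - w) * r =
      κ * ((v + Complex.I * (μ * δ)) * (-1 + Complex.I * κ / 2 * (v - w) * r) +
        (Complex.I * δ * v - μ) * (Complex.I * κ * (μ - Complex.I * δ * w) * r)) * l) := by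
  have hκ' : (κ : ℂ) ^ 2 * (1 + μ ^ 2) * (1 - δ ^ 2) = 1 := by exact_mod_cast hκ
  have hI := Complex.I_sq
  obtain ⟨a, ha⟩ : ∃ a : ℂ, a = κ * (μ - Complex.I * δ * w) := ⟨_, rfl⟩
  obtain ⟨b, hb⟩ : ∃ b : ℂ, b = κ * (Complex.I * δ * v - μ) := ⟨_, rfl⟩
  obtain ⟨β, hβ⟩ : ∃ β : ℂ, β = κ / 2 * (v - w) := ⟨_, rfl⟩
  -- The evolution has trace `2 * z` and determinant one.
  have hdet : β ^ 2 + a * b = -s ^ 2 := by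
    rw [hs, hz, ha, hb, hβ]
    linear_combination (-κ ^ 2 - κ ^ 2 * δ ^ 2 * Complex.I ^ 2) * hwv -
      κ ^ 2 * δ ^ 2 * (1 + μ ^ 2) * hI - hκ'
  have hll : l * (z + Complex.I * s) = 1 := by
    rw [hl]; linear_combination -s ^ 2 * hI + hs
  have h1 : Complex.I * κ * (μ - Complex.I * δ * w) * r = Complex.I * a * r := by
    rw [ha]; ring
  have h2 : Complex.I * κ / 2 * (v - w) * r = Complex.I * β * r := by
    rw [hβ]; ring
  have h3 (x y : ℂ) : κ * ((w + Complex.I * (μ * δ)) * x + (μ - Complex.I * δ * w) * y) =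
      (z - β) * x + a * y := by
    rw [hz, ha, hβ]; ring
  have h4 (x y : ℂ) : κ * ((v + Complex.I * (μ * δ)) * y + (Complex.I * δ * v - μ) * x) =
      (z + β) * y + b * x := by
    rw [hz, hb, hβ]; ring
  rw [h1, h2, h3, h3, h4, h4]
  clear h1 h2 h3 h4 ha hb hβ hκ hκ' hwv hz
  refine ⟨?_, ?_, ?_, ?_⟩
  · rw [hl]
    linear_combination a * hr - a * r * s * hI
  · rw [hl]
    linear_combination (β + Complex.I * s) * hr -
      β * r * s * hI - Complex.I * r * hdet
  · linear_combination -Complex.I * a * r * hll + l * a * r * s * hI - a * l * hr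
  · linear_combination (1 - Complex.I * β * r) * hll - Complex.I * r * l * hdet +
      (Complex.I * l * s - β * l) * hr + β * r * l * s * hI

/-! ### The Fourier functional and existence of the propagator -/

/-- The `X`-th Fourier coefficient as a linear functional on continuous functions. -/
def coeffFunctional (X : ℤ) : C(UnitAddCircle, ℂ) →ₗ[ℂ] ℂ where
  toFun f := fourierCoeff f X
  map_add' f g := by
    rw [ContinuousMap.coe_add, fourierCoeff.add]
    · rfl
    · exact f.continuous.integrable_of_hasCompactSupport (.of_compactSpace _)
    · exact g.continuous.integrable_of_hasCompactSupport (.of_compactSpace _)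
  map_smul' c f := by
    rw [ContinuousMap.coe_smul]
    exact fourierCoeff.const_smul _ _ _

theorem coeffFunctional_apply (X : ℤ) (f : C(UnitAddCircle, ℂ)) :
    coeffFunctional X f = ∫ p : UnitAddCircle, fourier (-X) p * f p ∂haarAddCircle := rfl

theorem coeffFunctional_fourier_mul (n X : ℤ) (f : C(UnitAddCircle, ℂ)) :
    coeffFunctional X (fourier n * f) = coeffFunctional (X - n) f := by
  simp only [coeffFunctional_apply, ContinuousMap.mul_apply]
  congr 1 with p
  rw [← mul_assoc, ← fourier_add]
  congr 3
  ring

theorem coeffFunctional_one (X : ℤ) : coeffFunctional X 1 = if X = 0 then 1 else 0 := by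
  have h := congrFun (fourierCoeff_fourier (T := 1) 0) X
  have h1 : (fourier 0 : C(UnitAddCircle, ℂ)) = 1 := by ext p; simp
  rw [h1] at h
  exact h.trans (by simp [Pi.single_apply])

/-- Bessel's inequality with the supremum norm. -/
theorem summable_norm_coeffFunctional_sq (f : C(UnitAddCircle, ℂ)) :
    (Summable fun X => ‖coeffFunctional X f‖ ^ 2) ∧
      ∑' X, ‖coeffFunctional X f‖ ^ 2 ≤ ‖f‖ ^ 2 := by
  have h := hasSum_sq_fourierCoeff (ContinuousMap.toLp 2 haarAddCircle ℂ f)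
  simp only [fourierCoeff_toLp] at h
  refine ⟨h.summable, h.tsum_eq.trans_le ?_⟩
  have h2 : ∀ᵐ p ∂(haarAddCircle : Measure UnitAddCircle),
      ‖ContinuousMap.toLp 2 haarAddCircle ℂ f p‖ ^ 2 ≤ ‖f‖ ^ 2 := by
    filter_upwards [ContinuousMap.coeFn_toLp (p := 2) (𝕜 := ℂ) haarAddCircle f] with p hp
    rw [hp]
    gcongr
    exact f.norm_coe_le_norm p
  refine (integral_mono_of_nonneg (.of_forall fun p => by positivity) (integrable_const _) h2).trans
    ?_
  simp

/-- The equations and the summability condition for the restriction to `εℤ²` of a pair of functions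
satisfying the axioms, in the coordinates `X = x / ε` and `T = t / ε`; the values at odd points are
eliminated. Here `μ` is the product of the mass and the lattice step and `κ` is the product of the
two normalization factors. -/
structure IsPropagator (κ μ δ : ℝ) (B₁ B₂ : ℤ → ℤ → ℂ) : Prop where
  fst_eq : ∀ X T, B₁ X T = κ * (B₁ (X + 1) (T - 1) - Complex.I * δ * B₂ (X + 1) (T - 1) +
    μ * (B₂ X (T - 1) + Complex.I * δ * B₁ X (T - 1)))
  snd_eq : ∀ X T, B₂ X T = κ * (B₂ (X - 1) (T - 1) + Complex.I * δ * B₁ (X - 1) (T - 1) -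
    μ * (B₁ X (T - 1) - Complex.I * δ * B₂ X (T - 1))) + if X = 0 ∧ T = 0 then 2 else 0
  summable : Summable fun q : ℤ × ℤ => ‖B₁ q.1 q.2‖ ^ 2 + ‖B₂ q.1 q.2‖ ^ 2

theorem symbolFst_apply (κ μ δ : ℝ) (h : (0 < κ ∧ 0 < μ * δ) ∨ κ ^ 2 < 1) (T : ℤ)
    (p : UnitAddCircle) : symbolFst κ μ δ h T p =
      Complex.I * κ * (μ - Complex.I * δ * fourier (-1) p) * (freqSin κ (μ * δ) p)⁻¹ *
        (halfTrace κ (μ * δ) p - Complex.I * freqSin κ (μ * δ) p) ^ T.natAbs := by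
  simp [symbolFst, freqSinInv, smallEigenvalue, -fourier_apply]

theorem symbolSnd_apply (κ μ δ : ℝ) (h : (0 < κ ∧ 0 < μ * δ) ∨ κ ^ 2 < 1) (T : ℤ)
    (p : UnitAddCircle) : symbolSnd κ μ δ h T p =
      ((if 0 ≤ T then 1 else -1) +
        Complex.I * κ / 2 * (fourier 1 p - fourier (-1) p) * (freqSin κ (μ * δ) p)⁻¹) *
        (halfTrace κ (μ * δ) p - Complex.I * freqSin κ (μ * δ) p) ^ T.natAbs := by
  unfold symbolSnd
  generalize (if 0 ≤ T then 1 else -1 : ℂ) = σ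
  simp [freqSinInv, smallEigenvalue, -fourier_apply]

theorem symbol_recursion {κ μ δ : ℝ} (hκ : κ ^ 2 * (1 + μ ^ 2) * (1 - δ ^ 2) = 1)
    (h : (0 < κ ∧ 0 < μ * δ) ∨ κ ^ 2 < 1) (T : ℤ) :
    symbolFst κ μ δ h T = (κ : ℂ) • (fourier (-1) * symbolFst κ μ δ h (T - 1) -
      (Complex.I * δ) • (fourier (-1) * symbolSnd κ μ δ h (T - 1)) +
      (μ : ℂ) • (symbolSnd κ μ δ h (T - 1) + (Complex.I * δ) • symbolFst κ μ δ h (T - 1))) ∧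
    symbolSnd κ μ δ h T = (κ : ℂ) • (fourier 1 * symbolSnd κ μ δ h (T - 1) +
      (Complex.I * δ) • (fourier 1 * symbolFst κ μ δ h (T - 1)) -
      (μ : ℂ) • (symbolFst κ μ δ h (T - 1) - (Complex.I * δ) • symbolSnd κ μ δ h (T - 1))) +
      (if T = 0 then 2 else 0 : ℂ) • 1 := by
  have key (p : UnitAddCircle) := symbol_eigenvector hκ (fourier_neg_one_mul_fourier_one p)
    (z := halfTrace κ (μ * δ) p) (s := freqSin κ (μ * δ) p) (r := (freqSin κ (μ * δ) p)⁻¹)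
    (by rw [fourier_neg_one_add_fourier_one, halfTrace]; push_cast; ring)
    (freqSin_sq _ _ _) (inv_mul_cancel₀ (freqSin_ne_zero h p)) rfl
  rcases le_or_gt T 0 with hT | hT
  · have h1 : (T - 1).natAbs = T.natAbs + 1 := by omega
    have h2 : (if T = 0 then 2 else 0 : ℂ) = (if 0 ≤ T then 1 else -1) + 1 := by
      rcases hT.lt_or_eq with h | h
      · rw [if_neg h.ne, if_neg (by omega)]; norm_num
      · rw [if_pos h, if_pos h.ge]; norm_num
    -- At `T = 0` the source accounts for the jump of the sign, the power of the eigenvalue being one.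
    have h3 (x : ℂ) : (if T = 0 then 2 else 0 : ℂ) * x ^ T.natAbs = if T = 0 then 2 else 0 := by
      split_ifs with h <;> simp [h]
    have h4 : ¬ 0 ≤ T - 1 := by omega
    constructor <;> ext p <;> obtain ⟨-, -, k1, k2⟩ := key p <;>
      simp only [ContinuousMap.add_apply, ContinuousMap.sub_apply, ContinuousMap.mul_apply,
        ContinuousMap.smul_apply, ContinuousMap.one_apply, smul_eq_mul, symbolFst_apply,
        symbolSnd_apply, h1, if_neg h4, pow_succ]
    · set l := halfTrace κ (μ * δ) p - Complex.I * freqSin κ (μ * δ) p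
      linear_combination l ^ T.natAbs * k1
    · have h5 := h3 (halfTrace κ (μ * δ) p - Complex.I * freqSin κ (μ * δ) p)
      set l := halfTrace κ (μ * δ) p - Complex.I * freqSin κ (μ * δ) p
      linear_combination l ^ T.natAbs * k2 + h5 - l ^ T.natAbs * h2
  · obtain ⟨n, rfl⟩ : ∃ n : ℕ, T = n + 1 := ⟨(T - 1).toNat, by omega⟩
    have h1 : (n + 1 : ℤ).natAbs = n + 1 := by omega
    have h2 : ¬ (n + 1 : ℤ) = 0 := by omega
    have h3 : (0 : ℤ) ≤ n + 1 := by omega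
    constructor <;> ext p <;> obtain ⟨k1, k2, -, -⟩ := key p <;>
      simp only [ContinuousMap.add_apply, ContinuousMap.sub_apply, ContinuousMap.mul_apply,
        ContinuousMap.smul_apply, ContinuousMap.one_apply, smul_eq_mul, symbolFst_apply,
        symbolSnd_apply, h1, if_neg h2, if_pos h3, add_sub_cancel_right, Int.natAbs_natCast,
        Int.natCast_nonneg, if_true, pow_succ]
    · set l := halfTrace κ (μ * δ) p - Complex.I * freqSin κ (μ * δ) p
      linear_combination l ^ n * k1
    · set l := halfTrace κ (μ * δ) p - Complex.I * freqSin κ (μ * δ) p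
      linear_combination l ^ n * k2

/-- A function of the form `(X, T) ↦ f̂_T(X)` is square-summable once the norms of `f_T` decay
exponentially in `|T|`. -/
theorem summable_norm_coeffFunctional_sq_prod (F : ℤ → C(UnitAddCircle, ℂ)) (C q : ℝ)
    (hq : 0 ≤ q) (hq1 : q < 1) (hF : ∀ T, ‖F T‖ ≤ C * q ^ T.natAbs) :
    Summable fun x : ℤ × ℤ => ‖coeffFunctional x.1 (F x.2)‖ ^ 2 := by
  suffices Summable fun x : ℤ × ℤ => ‖coeffFunctional x.2 (F x.1)‖ ^ 2 from
    (Equiv.prodComm ℤ ℤ).summable_iff.1 this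
  rw [summable_prod_of_nonneg fun x => by positivity]
  refine ⟨fun T => (summable_norm_coeffFunctional_sq (F T)).1, ?_⟩
  have hgeo : Summable fun n : ℕ => C ^ 2 * (q ^ 2) ^ n :=
    (summable_geometric_of_lt_one (by positivity) (by nlinarith)).mul_left _
  have hsum : Summable fun T : ℤ => C ^ 2 * (q ^ 2) ^ T.natAbs := by
    refine .of_nat_of_neg ?_ ?_ <;> simpa using hgeo
  refine .of_nonneg_of_le (fun T => tsum_nonneg fun X => by positivity) (fun T => ?_) hsum
  refine (summable_norm_coeffFunctional_sq (F T)).2.trans ?_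
  calc ‖F T‖ ^ 2 ≤ (C * q ^ T.natAbs) ^ 2 := by gcongr; exact hF T
    _ = _ := by rw [mul_pow, ← pow_mul, ← pow_mul, mul_comm 2]

theorem isPropagator_coeffFunctional_symbol {κ μ δ : ℝ}
    (hκ : κ ^ 2 * (1 + μ ^ 2) * (1 - δ ^ 2) = 1) (hκ0 : 0 < κ) (hη : 0 < μ * δ) :
    IsPropagator κ μ δ (fun X T => coeffFunctional X (symbolFst κ μ δ (.inl ⟨hκ0, hη⟩) T))
      fun X T => coeffFunctional X (symbolSnd κ μ δ (.inl ⟨hκ0, hη⟩) T) where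
  fst_eq X T := by
    conv_lhs => rw [(symbol_recursion hκ _ T).1]
    simp only [map_smul, map_add, map_sub, coeffFunctional_fourier_mul, smul_eq_mul, sub_neg_eq_add]
  snd_eq X T := by
    conv_lhs => rw [(symbol_recursion hκ _ T).2]
    simp only [map_smul, map_add, map_sub, coeffFunctional_fourier_mul, smul_eq_mul,
      coeffFunctional_one]
    congr 1
    split_ifs <;> simp_all
  summable := by
    have hl := norm_smallEigenvalue_lt_one hκ0 hη
    refine .add ?_ ?_
    · refine summable_norm_coeffFunctional_sq_prod _
        ‖(Complex.I * κ) • ((μ : ℂ) • 1 - (Complex.I * δ) • fourier (-1)) *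
          freqSinInv κ (μ * δ) (.inl ⟨hκ0, hη⟩)‖ _ (norm_nonneg _) hl fun T => ?_
      exact (norm_mul_le _ _).trans (mul_le_mul_of_nonneg_left (norm_pow_le _ _) (norm_nonneg _))
    · refine summable_norm_coeffFunctional_sq_prod _ 
        (1 + ‖(Complex.I * κ / 2) • (fourier 1 - fourier (-1)) *
          freqSinInv κ (μ * δ) (.inl ⟨hκ0, hη⟩)‖) _ (norm_nonneg _) hl fun T => ?_
      refine (norm_mul_le _ _).trans (mul_le_mul ?_ (norm_pow_le _ _) (norm_nonneg _)
        (by positivity))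
      refine (norm_add_le _ _).trans (add_le_add_left ?_ _)
      rw [norm_smul, norm_one, mul_one]
      split_ifs <;> simp

/-! ### Uniqueness of the propagator -/

/-- Square-summable functions on a lattice form products summable along any shift. -/
theorem summable_shift_mul_conj {G : Type*} [AddCommGroup G] {u : G → ℂ}
    (hu : Summable fun q => ‖u q‖ ^ 2) (e : G) :
    Summable fun q => u (q + e) * (starRingEnd ℂ) (u q) := by
  have h1 : Summable fun q => ‖u (q + e)‖ ^ 2 := 
    ((Equiv.addRight e).summable_iff (f := fun q => ‖u q‖ ^ 2)).2 hu
  refine .of_norm_bounded (h1.add hu) fun q => ?_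
  rw [norm_mul, RCLike.norm_conj]
  nlinarith [sq_nonneg (‖u (q + e)‖ - ‖u q‖), sq_nonneg ‖u (q + e)‖, sq_nonneg ‖u q‖]

theorem im_tsum_shift_add_shift_neg {G : Type*} [AddCommGroup G] {u : G → ℂ}
    (hu : Summable fun q => ‖u q‖ ^ 2) (e : G) :
    (∑' q, (u (q + e) + u (q + -e)) * (starRingEnd ℂ) (u q)).im = 0 := by
  simp only [add_mul]
  rw [(summable_shift_mul_conj hu e).tsum_add (summable_shift_mul_conj hu (-e))]
  have h : ∑' q, u (q + -e) * (starRingEnd ℂ) (u q) =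
      (starRingEnd ℂ) (∑' q, u (q + e) * (starRingEnd ℂ) (u q)) := by
    rw [Complex.conj_tsum, ← (Equiv.addRight e).tsum_eq]
    simp [mul_comm]
  rw [h, Complex.add_conj]
  simp

/-- The lattice Klein–Gordon equation with a nonreal mass term has no nonzero square-summable
solution: the shift operators enter it in self-adjoint combinations, hence pairing the equation with
the solution itself and taking the imaginary part leaves only the mass term. -/
theorem eq_zero_of_kleinGordon {κ η : ℝ} (hκ : κ ≠ 0) (hη : η ≠ 0) {u : ℤ × ℤ → ℂ}
    (hu : Summable fun q => ‖u q‖ ^ 2)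
    (h : ∀ q, u (q + (0, 1)) + u (q + -(0, 1)) =
      κ * (u (q + (1, 0)) + u (q + -(1, 0)) + 2 * Complex.I * η * u q)) : u = 0 := by
  have hT := im_tsum_shift_add_shift_neg hu (0, 1)
  have hX := im_tsum_shift_add_shift_neg hu (1, 0)
  have hs : Summable fun q => (u (q + (1, 0)) + u (q + -(1, 0))) * (starRingEnd ℂ) (u q) := by
    simp only [add_mul]
    exact (summable_shift_mul_conj hu _).add (summable_shift_mul_conj hu _)
  have hu' : Summable fun q => ((‖u q‖ ^ 2 : ℝ) : ℂ) := Complex.ofRealCLM.summable hu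
  have key : ∑' q, (u (q + (0, 1)) + u (q + -(0, 1))) * (starRingEnd ℂ) (u q) =
      κ * ∑' q, (u (q + (1, 0)) + u (q + -(1, 0))) * (starRingEnd ℂ) (u q) +
        2 * Complex.I * η * κ * ((∑' q, ‖u q‖ ^ 2 : ℝ) : ℂ) := by
    rw [Complex.ofReal_tsum, ← tsum_mul_left, ← tsum_mul_left,
      ← (hs.mul_left _).tsum_add (hu'.mul_left _)]
    congr 1 with q
    have hn : u q * (starRingEnd ℂ) (u q) = ((‖u q‖ ^ 2 : ℝ) : ℂ) := by
      rw [Complex.mul_conj, Complex.normSq_eq_norm_sq]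
    rw [h q, ← hn]
    ring
  have h0 : ∑' q, ‖u q‖ ^ 2 = 0 := by
    rw [key, Complex.add_im, Complex.im_ofReal_mul, hX] at hT
    simpa [hκ, hη] using hT
  have h1 := (hasSum_zero_iff_of_nonneg fun q => by positivity).1 (h0 ▸ hu.hasSum)
  ext q
  simpa using congrFun h1 q

theorem IsPropagator.unique {κ μ δ : ℝ} (hκ : κ ^ 2 * (1 + μ ^ 2) * (1 - δ ^ 2) = 1)
    (hμ : μ * δ ≠ 0) {B₁ B₂ B₁' B₂' : ℤ → ℤ → ℂ} (h : IsPropagator κ μ δ B₁ B₂)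
    (h' : IsPropagator κ μ δ B₁' B₂') : B₁ = B₁' ∧ B₂ = B₂' := by
  have hκ' : (κ : ℂ) ^ 2 * (1 + μ ^ 2) * (1 - δ ^ 2) = 1 := by exact_mod_cast hκ
  have hκ0 : κ ≠ 0 := by rintro rfl; simp at hκ
  have hI := Complex.I_sq
  set u₁ : ℤ × ℤ → ℂ := fun q => B₁ q.1 q.2 - B₁' q.1 q.2 with hu₁
  set u₂ : ℤ × ℤ → ℂ := fun q => B₂ q.1 q.2 - B₂' q.1 q.2 with hu₂
  have e₁ (X T : ℤ) : u₁ (X, T) = κ * (u₁ (X + 1, T - 1) - Complex.I * δ * u₂ (X + 1, T - 1) +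
      μ * (u₂ (X, T - 1) + Complex.I * δ * u₁ (X, T - 1))) := by
    simp only [hu₁, hu₂]
    rw [h.fst_eq X T, h'.fst_eq X T]
    ring
  have e₂ (X T : ℤ) : u₂ (X, T) = κ * (u₂ (X - 1, T - 1) + Complex.I * δ * u₁ (X - 1, T - 1) -
      μ * (u₁ (X, T - 1) - Complex.I * δ * u₂ (X, T - 1))) := by
    simp only [hu₁, hu₂]
    rw [h.snd_eq X T, h'.snd_eq X T]
    ring
  have hsum : Summable fun q => ‖u₁ q‖ ^ 2 + ‖u₂ q‖ ^ 2 := by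
    refine .of_nonneg_of_le (fun q => by positivity) (fun q => ?_)
      ((h.summable.add h'.summable).mul_left 2)
    have hab (a b : ℂ) : ‖a - b‖ ^ 2 ≤ 2 * (‖a‖ ^ 2 + ‖b‖ ^ 2) := by
      have := norm_sub_le a b
      nlinarith [sq_nonneg (‖a‖ - ‖b‖), norm_nonneg (a - b)]
    linarith [hab (B₁ q.1 q.2) (B₁' q.1 q.2), hab (B₂ q.1 q.2) (B₂' q.1 q.2)]
  -- The Cayley–Hamilton theorem for the one-step evolution, which has determinant one.
  have z₁ : u₁ = 0 := by
    refine eq_zero_of_kleinGordon hκ0 hμ (.of_nonneg_of_le (fun q => by positivity)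
      (fun q => by linarith [sq_nonneg ‖u₂ q‖]) hsum) ?_
    rintro ⟨X, T⟩
    have a1 := e₁ X (T + 1)
    have a2 := e₁ X T
    have a3 := e₂ X T
    have a4 := e₂ (X + 1) T
    have a5 := e₁ (X - 1) T
    simp only [add_sub_cancel_right, sub_add_cancel] at a1 a2 a3 a4 a5
    simp only [Prod.mk_add_mk, Prod.neg_mk, add_zero, neg_zero, ← sub_eq_add_neg]
    push_cast
    linear_combination a1 - κ * a5 - κ * Complex.I * μ * δ * a2 + κ * μ * a3 -
      κ * Complex.I * δ * a4 - u₁ (X, T - 1) * hκ' -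
      κ ^ 2 * δ ^ 2 * (1 + μ ^ 2) * u₁ (X, T - 1) * hI
  have z₂ : u₂ = 0 := by
    refine eq_zero_of_kleinGordon hκ0 hμ (.of_nonneg_of_le (fun q => by positivity)
      (fun q => by linarith [sq_nonneg ‖u₁ q‖]) hsum) ?_
    rintro ⟨X, T⟩
    have a1 := e₂ X (T + 1)
    have a2 := e₂ X T
    have a3 := e₁ X T
    have a4 := e₁ (X - 1) T
    have a5 := e₂ (X + 1) T
    simp only [add_sub_cancel_right, sub_add_cancel] at a1 a2 a3 a4 a5
    simp only [Prod.mk_add_mk, Prod.neg_mk, add_zero, neg_zero, ← sub_eq_add_neg]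
    push_cast
    linear_combination a1 - κ * a5 - κ * Complex.I * μ * δ * a2 - κ * μ * a3 +
      κ * Complex.I * δ * a4 - u₂ (X, T - 1) * hκ' -
      κ ^ 2 * δ ^ 2 * (1 + μ ^ 2) * u₂ (X, T - 1) * hI
  refine ⟨?_, ?_⟩ <;> ext X T
  · exact sub_eq_zero.1 (congrFun z₁ (X, T))
  · exact sub_eq_zero.1 (congrFun z₂ (X, T))

/-! ### The limit at time zero -/

/-- The Fourier coefficients of the pointwise inverse of `freqSin`. -/
def invSinCoeff (κ η : ℝ) (X : ℤ) : ℂ :=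
  ∫ p : UnitAddCircle, fourier (-X) p * (freqSin κ η p)⁻¹ ∂haarAddCircle

/-- Dominated convergence applies because `‖freqSin‖ ^ 2` is at least `1 - κ ^ 2`, and the latter is
bounded away from zero near `κ = c`. -/
theorem continuousAt_invSinCoeff {c : ℝ} (hc : c ^ 2 < 1) (X : ℤ) :
    ContinuousAt (fun q : ℝ × ℝ => invSinCoeff q.1 q.2 X) (c, 0) := by
  unfold invSinCoeff
  have hev : ∀ᶠ q : ℝ × ℝ in 𝓝 (c, 0), (1 - c ^ 2) / 2 < 1 - q.1 ^ 2 := by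
    have : ContinuousAt (fun q : ℝ × ℝ => 1 - q.1 ^ 2) (c, 0) := by fun_prop
    exact this.eventually (lt_mem_nhds (by simp only; linarith))
  refine continuousAt_of_dominated (bound := fun _ => (√((1 - c ^ 2) / 2))⁻¹) ?_ ?_
    (integrable_const _) (.of_forall fun p => ?_)
  · filter_upwards [hev] with q hq
    have h : (0 < q.1 ∧ 0 < q.2) ∨ q.1 ^ 2 < 1 := .inr (by linarith)
    exact ((fourier (-X)).continuous.mul
      ((continuous_freqSin h).inv₀ (freqSin_ne_zero h))).aestronglyMeasurable
  · filter_upwards [hev] with q hq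
    refine .of_forall fun p => ?_
    have hf : ‖fourier (-X) p‖ = 1 := by rw [fourier_apply, Circle.norm_coe]
    rw [norm_mul, hf, one_mul, norm_inv]
    refine inv_anti₀ (Real.sqrt_pos.2 (by linarith)) (Real.sqrt_le_iff.2 ⟨norm_nonneg _, ?_⟩)
    rw [← norm_pow, freqSin_sq]
    exact hq.le.trans ((one_sub_sq_le_re _ _ p).trans (Complex.re_le_norm _))
  · have hs := one_sub_halfTrace_sq_mem_slitPlane (κ := c) (η := 0) (.inr hc) p
    refine continuousAt_const.mul (ContinuousAt.inv₀ ?_ (freqSin_ne_zero (.inr hc) p))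
    unfold freqSin
    refine ContinuousAt.cpow ?_ continuousAt_const hs
    unfold halfTrace
    fun_prop

theorem momentumCos_neg (p : UnitAddCircle) : momentumCos (-p) = momentumCos p := by
  have : fourier 1 (-p) = fourier (-1) p := by simp [fourier_apply]
  rw [momentumCos, this, fourier_neg, Complex.conj_re, momentumCos]

theorem fourier_add_half {n : ℤ} (hn : Odd n) (p : UnitAddCircle) :
    fourier n (p + ((1 / 2 : ℝ) : UnitAddCircle)) = -fourier n p := by
  have h1 : (toCircle ((1 / 2 : ℝ) : UnitAddCircle) : ℂ) = -1 := by
    have := fourier_add_half_inv_index (T := 1) one_ne_zero one_pos 0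
    simpa [fourier_one] using this
  have h2 : (2 : ℤ) • ((1 / 2 : ℝ) : UnitAddCircle) = 0 := by
    rw [← AddCircle.coe_zsmul]
    norm_num
  obtain ⟨k, rfl⟩ := hn
  rw [fourier_apply, fourier_apply, smul_add, add_smul (2 * k) 1 ((1 / 2 : ℝ) : UnitAddCircle),
    mul_comm 2 k, mul_smul k 2 ((1 / 2 : ℝ) : UnitAddCircle), h2, smul_zero, one_smul, zero_add,
    toCircle_add, Circle.coe_mul, h1]
  ring

theorem momentumCos_add_half (p : UnitAddCircle) :
    momentumCos (p + ((1 / 2 : ℝ) : UnitAddCircle)) = -momentumCos p := by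
  rw [momentumCos, fourier_add_half odd_one, Complex.neg_re, momentumCos]

theorem freqSin_zero {c : ℝ} (hc : c ^ 2 < 1) (p : UnitAddCircle) :
    freqSin c 0 p = (√(1 - c ^ 2 * momentumCos p ^ 2) : ℝ) := by
  have h : 0 ≤ 1 - c ^ 2 * momentumCos p ^ 2 := by
    have h1 := one_sub_sq_le_re c 0 p
    rw [one_sub_halfTrace_sq_re] at h1
    linarith
  have h2 : (1 : ℂ) - halfTrace c 0 p ^ 2 = ((1 - c ^ 2 * momentumCos p ^ 2 : ℝ) : ℂ) := by
    simp [halfTrace]; ring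
  rw [freqSin, h2, Real.sqrt_eq_rpow, Complex.ofReal_cpow h]
  norm_num

/-- The Fourier coefficients of `1 / sin ω`, where `ω` is the frequency, are real. -/
theorem invSinCoeff_im {c : ℝ} (hc : c ^ 2 < 1) (X : ℤ) : (invSinCoeff c 0 X).im = 0 := by
  rw [invSinCoeff, ← Complex.conj_eq_iff_im, ← integral_conj, ← integral_neg_eq_self]
  congr 1 with p
  rw [freqSin_zero hc, freqSin_zero hc, momentumCos_neg, map_mul, map_inv₀, Complex.conj_ofReal,
    ← fourier_neg]
  simp [fourier_apply]

/-- The Fourier coefficients of `1 / sin ω` with odd indices vanish, because the half-period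
translation of the momentum preserves `sin ω`. -/
theorem invSinCoeff_of_odd {c : ℝ} (hc : c ^ 2 < 1) {X : ℤ} (hX : Odd X) :
    invSinCoeff c 0 X = 0 := by
  have h := integral_add_right_eq_self (μ := (haarAddCircle : Measure UnitAddCircle))
    (fun p => fourier (-X) p * (freqSin c 0 p)⁻¹) ((1 / 2 : ℝ) : UnitAddCircle)
  simp only [freqSin_zero hc, momentumCos_add_half, fourier_add_half hX.neg, neg_sq, neg_mul,
    integral_neg] at h
  simp only [invSinCoeff, freqSin_zero hc]
  exact self_eq_neg.1 h.symm

theorem coeffFunctional_symbolFst_zero (κ μ δ : ℝ) (h : (0 < κ ∧ 0 < μ * δ) ∨ κ ^ 2 < 1) (X : ℤ) :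
    coeffFunctional X (symbolFst κ μ δ h 0) = Complex.I * κ *
      (μ * coeffFunctional X (freqSinInv κ (μ * δ) h) -
        Complex.I * δ * coeffFunctional (X + 1) (freqSinInv κ (μ * δ) h)) := by
  simp only [symbolFst, Int.natAbs_zero, pow_zero, mul_one, smul_mul_assoc, sub_mul, one_mul,
    map_smul, map_sub, coeffFunctional_fourier_mul, smul_eq_mul, sub_neg_eq_add]

theorem coeffFunctional_symbolSnd_zero (κ μ δ : ℝ) (h : (0 < κ ∧ 0 < μ * δ) ∨ κ ^ 2 < 1) (X : ℤ) :
    coeffFunctional X (symbolSnd κ μ δ h 0) = (if X = 0 then 1 else 0) + Complex.I * κ / 2 *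
      (coeffFunctional (X - 1) (freqSinInv κ (μ * δ) h) -
        coeffFunctional (X + 1) (freqSinInv κ (μ * δ) h)) := by
  simp only [symbolSnd, Int.natAbs_zero, pow_zero, mul_one, smul_mul_assoc, sub_mul, one_smul,
    map_smul, map_sub, map_add, coeffFunctional_fourier_mul, smul_eq_mul, sub_neg_eq_add, le_refl,
    if_true, coeffFunctional_one]

/-- The values at time zero of a propagator. -/
theorem IsPropagator.at_zero {κ μ δ : ℝ} (hκ : κ ^ 2 * (1 + μ ^ 2) * (1 - δ ^ 2) = 1)
    (hκ0 : 0 < κ) (hη : 0 < μ * δ) {B₁ B₂ : ℤ → ℤ → ℂ} (h : IsPropagator κ μ δ B₁ B₂) (X : ℤ) :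
    B₁ X 0 = Complex.I * κ *
      (μ * invSinCoeff κ (μ * δ) X - Complex.I * δ * invSinCoeff κ (μ * δ) (X + 1)) ∧
    B₂ X 0 = (if X = 0 then 1 else 0) + Complex.I * κ / 2 *
      (invSinCoeff κ (μ * δ) (X - 1) - invSinCoeff κ (μ * δ) (X + 1)) := by
  have hJ (X : ℤ) : invSinCoeff κ (μ * δ) X =
    coeffFunctional X (freqSinInv κ (μ * δ) (.inl ⟨hκ0, hη⟩)) := rfl
  obtain ⟨h₁, h₂⟩ := h.unique hκ hη.ne' (isPropagator_coeffFunctional_symbol hκ hκ0 hη)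
  rw [h₁, h₂]
  simp only [hJ, coeffFunctional_symbolFst_zero, coeffFunctional_symbolSnd_zero, and_self]

/-! ### The limit at all times -/

/-- The real and the imaginary part of the amplitude of Feynman checkers at the point
`(ε * X, ε * (n + 1))`, described by the evolution in time; `c` stands for the normalization factor
and `μ` for the product of the mass and the lattice step. -/
def latticeAmplitude (c μ : ℝ) : ℕ → ℤ → ℝ × ℝ
  | 0, X => (0, if X = 1 then 1 else 0)
  | n + 1, X => (c * ((latticeAmplitude c μ n (X + 1)).1 + μ * (latticeAmplitude c μ n (X + 1)).2),
      c * ((latticeAmplitude c μ n (X - 1)).2 - μ * (latticeAmplitude c μ n (X - 1)).1))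

/-- The first component is even. The backward evolution produces the amplitude at the reflected
point, and this symmetry is what brings it back. -/
theorem latticeAmplitude_fst_neg {c μ : ℝ} (hc : c ^ 2 * (1 + μ ^ 2) = 1) (n : ℕ) :
    (∀ X, (latticeAmplitude c μ n (-X)).1 = (latticeAmplitude c μ n X).1) ∧
      ∀ X, (latticeAmplitude c μ (n + 1) (-X)).1 = (latticeAmplitude c μ (n + 1) X).1 := by
  -- The first component satisfies the lattice Klein–Gordon equation.
  have kg (n : ℕ) (X : ℤ) : (latticeAmplitude c μ (n + 2) X).1 =
      c * ((latticeAmplitude c μ (n + 1) (X + 1)).1 + (latticeAmplitude c μ (n + 1) (X - 1)).1) -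
        (latticeAmplitude c μ n X).1 := by
    simp only [latticeAmplitude, add_sub_cancel_right, sub_add_cancel]
    linear_combination (-(latticeAmplitude c μ n X).1) * hc
  induction n with
  | zero => simp [latticeAmplitude]
  | succ n ih =>
    refine ⟨ih.2, fun X => ?_⟩
    rw [kg, kg, ih.1, ← ih.2 (X + 1), ← ih.2 (X - 1), neg_add', neg_sub', sub_neg_eq_add,
      add_comm (latticeAmplitude c μ (n + 1) _).1]

/-- The evolution backward in time, given by the adjugate of the one-step evolution, which has
determinant one. Here `C` is the second component with the source subtracted. -/
theorem IsPropagator.backward {κ μ δ : ℝ} (hκ : κ ^ 2 * (1 + μ ^ 2) * (1 - δ ^ 2) = 1)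
    {B₁ B₂ : ℤ → ℤ → ℂ} (h : IsPropagator κ μ δ B₁ B₂) {C : ℤ → ℤ → ℂ}
    (hC : C = fun X T => B₂ X T - if X = 0 ∧ T = 0 then 2 else 0) (X T : ℤ) :
    B₁ X (T - 1) = κ * (B₁ (X - 1) T + Complex.I * μ * δ * B₁ X T - μ * C X T +
      Complex.I * δ * C (X + 1) T) ∧
    B₂ X (T - 1) = κ * (C (X + 1) T + Complex.I * μ * δ * C X T - Complex.I * δ * B₁ (X - 1) T +
      μ * B₁ X T) := by
  have hκ' : (κ : ℂ) ^ 2 * (1 + μ ^ 2) * (1 - δ ^ 2) = 1 := by exact_mod_cast hκ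
  have hI := Complex.I_sq
  have e₂ (X T : ℤ) : C X T = κ * (B₂ (X - 1) (T - 1) + Complex.I * δ * B₁ (X - 1) (T - 1) -
      μ * (B₁ X (T - 1) - Complex.I * δ * B₂ X (T - 1))) := by
    rw [hC]
    exact sub_eq_iff_eq_add.2 (h.snd_eq X T)
  have a1 := h.fst_eq X T
  have a2 := h.fst_eq (X - 1) T
  have a3 := e₂ X T
  have a4 := e₂ (X + 1) T
  simp only [add_sub_cancel_right, sub_add_cancel] at a1 a2 a3 a4
  constructor
  · linear_combination -κ * a2 - κ * Complex.I * μ * δ * a1 + κ * μ * a3 -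
      κ * Complex.I * δ * a4 - B₁ X (T - 1) * hκ' - κ ^ 2 * δ ^ 2 * (1 + μ ^ 2) * B₁ X (T - 1) * hI
  · linear_combination -κ * a4 - κ * Complex.I * μ * δ * a3 + κ * Complex.I * δ * a2 -
      κ * μ * a1 - B₂ X (T - 1) * hκ' - κ ^ 2 * δ ^ 2 * (1 + μ ^ 2) * B₂ X (T - 1) * hI

section Limit

variable {c μ : ℝ} {κ : ℝ → ℝ} {B₁ B₂ : ℝ → ℤ → ℤ → ℂ}

/-- The limit of the propagator at time zero. The two sublattices are already visible here: on one
of them only the contribution of the source survives, and on the other one the limit is purely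
imaginary. -/
theorem tendsto_propagator_zero (hc : c ^ 2 < 1) (hμ : 0 < μ)
    (hκ0 : ∀ δ, 0 < δ → δ < 1 → 0 < κ δ)
    (hκ : ∀ δ, 0 < δ → δ < 1 → κ δ ^ 2 * (1 + μ ^ 2) * (1 - δ ^ 2) = 1)
    (hκc : Tendsto κ (𝓝[>] 0) (𝓝 c))
    (hB : ∀ δ, 0 < δ → δ < 1 → IsPropagator (κ δ) μ δ (B₁ δ) (B₂ δ)) (X : ℤ) :
    ∃ l₁ l₂ : ℂ, Tendsto (fun δ => B₁ δ X 0) (𝓝[>] 0) (𝓝 l₁) ∧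
      Tendsto (fun δ => B₂ δ X 0) (𝓝[>] 0) (𝓝 (l₂ + if X = 0 then 1 else 0)) ∧
      l₁.re = 0 ∧ l₂.re = 0 ∧ (Odd X → l₁ = 0) ∧ (Even X → l₂ = 0) := by
  have hδ : Tendsto (fun δ : ℝ => δ) (𝓝[>] 0) (𝓝 0) := tendsto_id.mono_left nhdsWithin_le_nhds
  have hη : Tendsto (fun δ : ℝ => μ * δ) (𝓝[>] 0) (𝓝 0) := by simpa using hδ.const_mul μ
  have hlim (X : ℤ) : Tendsto (fun δ => invSinCoeff (κ δ) (μ * δ) X) (𝓝[>] 0)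
      (𝓝 (invSinCoeff c 0 X)) := by
    have h : Tendsto (fun q : ℝ × ℝ => invSinCoeff q.1 q.2 X) (𝓝 (c, 0))
      (𝓝 (invSinCoeff c 0 X)) := continuousAt_invSinCoeff hc X
    have h' : Tendsto (fun δ => (κ δ, μ * δ)) (𝓝[>] 0) (𝓝 (c, 0)) := hκc.prodMk_nhds hη
    have := Tendsto.comp h h'
    exact this
  have hκc' : Tendsto (fun δ => (κ δ : ℂ)) (𝓝[>] 0) (𝓝 c) := hκc.ofReal
  have hδ' : Tendsto (fun δ : ℝ => (δ : ℂ)) (𝓝[>] 0) (𝓝 (0 : ℝ)) := hδ.ofReal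
  have hev : ∀ᶠ δ : ℝ in 𝓝[>] 0, 0 < δ ∧ δ < 1 := Ioo_mem_nhdsGT one_pos
  have him := invSinCoeff_im hc
  have hval {δ : ℝ} (h0 : 0 < δ) (h1 : δ < 1) :=
    (hB δ h0 h1).at_zero (hκ δ h0 h1) (hκ0 δ h0 h1) (mul_pos hμ h0) X
  refine ⟨Complex.I * c * (μ * invSinCoeff c 0 X - Complex.I * (0 : ℝ) * invSinCoeff c 0 (X + 1)),
    Complex.I * c / 2 * (invSinCoeff c 0 (X - 1) - invSinCoeff c 0 (X + 1)), ?_, ?_, ?_, ?_, ?_, ?_⟩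
  · refine ((tendsto_const_nhds.mul hκc').mul ((tendsto_const_nhds.mul (hlim X)).sub
      ((tendsto_const_nhds.mul hδ').mul (hlim (X + 1))))).congr' ?_
    filter_upwards [hev] with δ ⟨h0, h1⟩
    exact (hval h0 h1).1.symm
  · rw [add_comm]
    refine (tendsto_const_nhds.add (((tendsto_const_nhds.mul hκc').div_const 2).mul
      ((hlim (X - 1)).sub (hlim (X + 1))))).congr' ?_
    filter_upwards [hev] with δ ⟨h0, h1⟩
    exact (hval h0 h1).2.symm
  · simp [him]
  · simp [him]
  · intro hX
    simp [invSinCoeff_of_odd hc hX]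
  · intro hX
    simp [invSinCoeff_of_odd hc (hX.sub_odd odd_one), invSinCoeff_of_odd hc (hX.add_odd odd_one)]

/-- The limit of the propagator at a nonnegative time. In the limit the evolution is real and does
not mix the two sublattices, so that it suffices to know the values at time zero. -/
theorem tendsto_propagator_natCast (hc : c ^ 2 < 1) (hμ : 0 < μ)
    (hκ0 : ∀ δ, 0 < δ → δ < 1 → 0 < κ δ)
    (hκ : ∀ δ, 0 < δ → δ < 1 → κ δ ^ 2 * (1 + μ ^ 2) * (1 - δ ^ 2) = 1)
    (hκc : Tendsto κ (𝓝[>] 0) (𝓝 c))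
    (hB : ∀ δ, 0 < δ → δ < 1 → IsPropagator (κ δ) μ δ (B₁ δ) (B₂ δ)) (n : ℕ) :
    ∀ X : ℤ, ∃ l₁ l₂ : ℂ, Tendsto (fun δ => B₁ δ X n) (𝓝[>] 0) (𝓝 l₁) ∧
      Tendsto (fun δ => B₂ δ X n) (𝓝[>] 0) (𝓝 l₂) ∧
      (Odd (X + n) → l₁ = (latticeAmplitude c μ n X).1 ∧ l₂.re = 0) ∧
      (Even (X + n) → l₂ = (latticeAmplitude c μ n (X + 1)).2 ∧ l₁.re = 0) := by
  induction n with
  | zero =>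
    intro X
    obtain ⟨l₁, l₂, h₁, h₂, hr₁, hr₂, ho, he⟩ :=
      tendsto_propagator_zero hc hμ hκ0 hκ hκc hB X
    refine ⟨_, _, h₁, h₂, fun hX => ?_, fun hX => ?_⟩
    · have hX' : Odd X := by simpa using hX
      have hne : X ≠ 0 := by rintro rfl; simp at hX'
      simp [latticeAmplitude, ho hX', hr₂, hne]
    · have hX' : Even X := by simpa using hX
      simp [latticeAmplitude, he hX', hr₁]
      split_ifs <;> simp
  | succ n ih =>
    choose L₁ L₂ h₁ h₂ ho he using ih
    have hev : ∀ᶠ δ : ℝ in 𝓝[>] 0, 0 < δ ∧ δ < 1 := Ioo_mem_nhdsGT one_pos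
    have hκc' : Tendsto (fun δ => (κ δ : ℂ)) (𝓝[>] 0) (𝓝 c) := hκc.ofReal
    have hδ : Tendsto (fun δ : ℝ => Complex.I * (δ : ℂ)) (𝓝[>] 0) (𝓝 0) := by
      have : Tendsto (fun δ : ℝ => δ) (𝓝[>] 0) (𝓝 0) := tendsto_id.mono_left nhdsWithin_le_nhds
      simpa using this.ofReal.const_mul Complex.I
    have hT : ((n + 1 : ℕ) : ℤ) - 1 = n := by push_cast; ring
    have hne : ((n + 1 : ℕ) : ℤ) ≠ 0 := by omega
    intro X
    refine ⟨c * (L₁ (X + 1) - 0 * L₂ (X + 1) + μ * (L₂ X + 0 * L₁ X)),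
      c * (L₂ (X - 1) + 0 * L₁ (X - 1) - μ * (L₁ X - 0 * L₂ X)), ?_, ?_, fun hX => ?_, fun hX => ?_⟩
    · refine (hκc'.mul (((h₁ _).sub (hδ.mul (h₂ _))).add
        (((h₂ _).add (hδ.mul (h₁ _))).const_mul _))).congr' ?_
      filter_upwards [hev] with δ ⟨h0, h1⟩
      rw [(hB δ h0 h1).fst_eq X (n + 1 : ℕ), hT]
    · refine (hκc'.mul (((h₂ _).add (hδ.mul (h₁ _))).sub
        (((h₁ _).sub (hδ.mul (h₂ _))).const_mul _))).congr' ?_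
      filter_upwards [hev] with δ ⟨h0, h1⟩
      rw [(hB δ h0 h1).snd_eq X (n + 1 : ℕ), hT, if_neg (fun h => hne h.2), add_zero]
    · have p1 : Even (X + n) := by grind
      have p2 : Odd (X + 1 + n) := by grind
      have p3 : Odd (X - 1 + n) := by grind
      simp [latticeAmplitude, (ho _ p2).1, (he _ p1).1, (ho _ p3).2, (he _ p1).2]
    · have p1 : Odd (X + n) := by grind
      have p2 : Even (X + 1 + n) := by grind
      have p3 : Even (X - 1 + n) := by grind
      simp [latticeAmplitude, (he _ p3).1, (ho _ p1).1, (he _ p2).2, (ho _ p1).2]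

/-- The limit of the propagator at a nonpositive time, by the backward evolution. Once the source is
subtracted, the second component changes its sign between the two directions of time. -/
theorem tendsto_propagator_neg_natCast (hc : c ^ 2 < 1) (hμ : 0 < μ)
    (hκ0 : ∀ δ, 0 < δ → δ < 1 → 0 < κ δ)
    (hκ : ∀ δ, 0 < δ → δ < 1 → κ δ ^ 2 * (1 + μ ^ 2) * (1 - δ ^ 2) = 1)
    (hκc : Tendsto κ (𝓝[>] 0) (𝓝 c))
    (hB : ∀ δ, 0 < δ → δ < 1 → IsPropagator (κ δ) μ δ (B₁ δ) (B₂ δ)) (n : ℕ) :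
    ∀ X : ℤ, ∃ l₁ l₂ : ℂ, Tendsto (fun δ => B₁ δ X (-n)) (𝓝[>] 0) (𝓝 l₁) ∧
      Tendsto (fun δ => B₂ δ X (-n) - if X = 0 ∧ (-n : ℤ) = 0 then 2 else 0) (𝓝[>] 0) (𝓝 l₂) ∧
      (Odd (X + n) → l₁ = (latticeAmplitude c μ n (-X)).1 ∧ l₂.re = 0) ∧
      (Even (X + n) → l₂ = -(latticeAmplitude c μ n (-X + 1)).2 ∧ l₁.re = 0) := by
  induction n with
  | zero =>
    intro X
    obtain ⟨l₁, l₂, h₁, h₂, hr₁, hr₂, ho, he⟩ :=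
      tendsto_propagator_zero hc hμ hκ0 hκ hκc hB X
    refine ⟨_, _, by simpa using h₁, by simpa using h₂.sub_const (if X = 0 then 2 else 0),
      fun hX => ?_, fun hX => ?_⟩
    · have hX' : Odd X := by simpa using hX
      have hne : X ≠ 0 := by rintro rfl; simp at hX'
      simp [latticeAmplitude, ho hX', hr₂, hne]
    · have hX' : Even X := by simpa using hX
      refine ⟨?_, hr₁⟩
      by_cases hX0 : X = 0 <;> simp [latticeAmplitude, he hX', hX0]
      norm_num
  | succ n ih =>
    choose L₁ L₂ h₁ h₂ ho he using ih
    have hev : ∀ᶠ δ : ℝ in 𝓝[>] 0, 0 < δ ∧ δ < 1 := Ioo_mem_nhdsGT one_pos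
    have hκc' : Tendsto (fun δ => (κ δ : ℂ)) (𝓝[>] 0) (𝓝 c) := hκc.ofReal
    have hδ (a : ℂ) : Tendsto (fun δ : ℝ => a * (δ : ℂ)) (𝓝[>] 0) (𝓝 0) := by
      have : Tendsto (fun δ : ℝ => δ) (𝓝[>] 0) (𝓝 0) := tendsto_id.mono_left nhdsWithin_le_nhds
      simpa using this.ofReal.const_mul a
    have hδ₁ := hδ Complex.I
    have hδ₂ := hδ (Complex.I * μ)
    have hT : (-(n + 1 : ℕ) : ℤ) = -n - 1 := by push_cast; ring
    have hne : (-n - 1 : ℤ) ≠ 0 := by omega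
    intro X
    simp only [hT, hne, and_false, if_false, sub_zero]
    refine ⟨c * (L₁ (X - 1) + 0 * L₁ X - μ * L₂ X + 0 * L₂ (X + 1)),
      c * (L₂ (X + 1) + 0 * L₂ X - 0 * L₁ (X - 1) + μ * L₁ X), ?_, ?_, fun hX => ?_, fun hX => ?_⟩
    · refine (hκc'.mul ((((h₁ _).add (hδ₂.mul (h₁ _))).sub ((h₂ _).const_mul _)).add
        (hδ₁.mul (h₂ _)))).congr' ?_
      filter_upwards [hev] with δ ⟨h0, h1⟩
      exact ((hB δ h0 h1).backward (hκ δ h0 h1) rfl X _).1.symm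
    · refine (hκc'.mul ((((h₂ _).add (hδ₂.mul (h₂ _))).sub (hδ₁.mul (h₁ _))).add
        ((h₁ _).const_mul _))).congr' ?_
      filter_upwards [hev] with δ ⟨h0, h1⟩
      exact ((hB δ h0 h1).backward (hκ δ h0 h1) rfl X _).2.symm
    · have p1 : Even (X + n) := by grind
      have p2 : Odd (X + 1 + n) := by grind
      have p3 : Odd (X - 1 + n) := by grind
      have e : -(X - 1) = -X + 1 := by ring
      simp [latticeAmplitude, (ho _ p3).1, (he _ p1).1, (ho _ p2).2, (he _ p1).2, e]
    · have p1 : Odd (X + n) := by grind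
      have p2 : Even (X + 1 + n) := by grind
      have p3 : Even (X - 1 + n) := by grind
      have e : -(X + 1) + 1 = -X := by ring
      simp only [latticeAmplitude, (he _ p2).1, (ho _ p1).1, add_sub_cancel_right, e]
      refine ⟨?_, by simp [(he _ p3).2, (ho _ p1).2]⟩
      push_cast
      ring

end Limit

/-! ### Checker paths and their amplitudes -/

/-- The horizontal displacement of a step, `true` being a step to the right. -/
def stepSign (b : Bool) : ℤ := if b then 1 else -1

/-- The direction of the last step of the path encoded by a list of directions: the path starts with
a step to the right, and the list contains the directions of the other steps, the last step
first. -/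
def lastDir (s : List Bool) : Bool := s.headD true

/-- The endpoint abscissa, divided by `ε`, of the path encoded by a list of directions. -/
def pathEnd : List Bool → ℤ
  | [] => 1
  | b :: s => pathEnd s + stepSign b

/-- The checker path encoded by a list of directions, as in `lastDir`. -/
def pathOf (ε : ℝ) : List Bool → List (ℝ × ℝ)
  | [] => [(0, 0), (ε, ε)]
  | b :: s => pathOf ε s ++ [(ε * pathEnd (b :: s), ε * ((s.length + 1 : ℕ) + 1))]

theorem length_pathOf (ε : ℝ) (s : List Bool) : (pathOf ε s).length = s.length + 2 := by
  induction s with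
  | nil => rfl
  | cons b s ih => simp [pathOf, ih]

/-- The last two points of an encoded path. -/
theorem pathOf_eq_append (ε : ℝ) (s : List Bool) : ∃ l, pathOf ε s = l ++
    [(ε * (pathEnd s - stepSign (lastDir s)), ε * s.length),
      (ε * pathEnd s, ε * (s.length + 1))] := by
  cases s with
  | nil => exact ⟨[], by simp [pathOf, pathEnd, lastDir, stepSign]⟩
  | cons b s =>
    cases s with
    | nil => exact ⟨[(0, 0)], by simp [pathOf, pathEnd, lastDir]⟩
    | cons b' s =>
      refine ⟨pathOf ε s, ?_⟩
      simp [pathOf, pathEnd, lastDir]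

theorem getLast?_pathOf (ε : ℝ) (s : List Bool) :
    (pathOf ε s).getLast? = some (ε * pathEnd s, ε * (s.length + 1)) := by
  obtain ⟨l, hl⟩ := pathOf_eq_append ε s
  simp [hl]

theorem head?_pathOf (ε : ℝ) (s : List Bool) : (pathOf ε s).head? = some (0, 0) := by
  induction s with
  | nil => rfl
  | cons b s ih => simp [pathOf, ih]

theorem mem_pathOf (ε : ℝ) (s : List Bool) : (ε, ε) ∈ pathOf ε s := by
  induction s with
  | nil => simp [pathOf]
  | cons b s ih => simp [pathOf, ih]

theorem mem_squareLattice_mul (ε : ℝ) (X T : ℤ) : (ε * X, ε * T) ∈ squareLattice ε := by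
  obtain ⟨k, hk⟩ := exists_int_eq_div_self ε
  constructor
  · exact ⟨k * X, by simp only; rw [mul_div_right_comm, hk]; push_cast; ring⟩
  · exact ⟨k * T, by simp only; rw [mul_div_right_comm, hk]; push_cast; ring⟩

theorem step_cases (ε : ℝ) (X n : ℤ) (b : Bool) :
    ((ε * (X + stepSign b : ℤ), ε * (n + 1)) - (ε * X, ε * n) : ℝ × ℝ) = (ε, ε) ∨
      ((ε * (X + stepSign b : ℤ), ε * (n + 1)) - (ε * X, ε * n) : ℝ × ℝ) = (-ε, ε) := by
  cases b
  · right; ext <;> simp [stepSign] <;> ring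
  · left; ext <;> simp [stepSign] <;> ring

theorem isCheckerPath_pathOf (ε : ℝ) (s : List Bool) : IsCheckerPath ε (pathOf ε s) := by
  induction s with
  | nil =>
    refine ⟨?_, by simp [pathOf]⟩
    have h0 := mem_squareLattice_mul ε 0 0
    have h1 := mem_squareLattice_mul ε 1 1
    simpa [pathOf] using And.intro h0 h1
  | cons b s ih =>
    refine ⟨?_, ?_⟩
    · simp only [pathOf, List.mem_append, List.mem_singleton]
      rintro p (hp | rfl)
      · exact ih.1 p hp
      · exact_mod_cast mem_squareLattice_mul ε _ (s.length + 1 + 1)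
    · rw [pathOf, List.isChain_append]
      refine ⟨ih.2, by simp, ?_⟩
      intro p hp q hq
      rw [getLast?_pathOf, Option.mem_some_iff] at hp
      simp only [List.head?_cons, Option.mem_some_iff] at hq
      subst hp hq
      have := step_cases ε (pathEnd s) (s.length + 1) b
      rw [pathEnd]
      push_cast at this ⊢
      exact this

theorem pathOf_injective {ε : ℝ} (hε : ε ≠ 0) : Function.Injective (pathOf ε) := by
  intro s
  induction s with
  | nil =>
    intro s' h
    have := congrArg List.length h
    rw [length_pathOf, length_pathOf] at this
    exact (List.length_eq_zero_iff.1 (by simpa using this.symm)).symm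
  | cons b s ih =>
    intro s' h
    cases s' with
    | nil =>
      have := congrArg List.length h
      rw [length_pathOf, length_pathOf] at this
      simp at this
    | cons b' s' =>
      obtain ⟨h1, h2⟩ := List.append_inj' h rfl
      obtain rfl := ih h1
      simp only [List.cons.injEq, Prod.mk.injEq, mul_eq_mul_left_iff, hε, or_false, Int.cast_inj,
        pathEnd, add_right_inj] at h2
      have : b = b' := by
        cases b <;> cases b' <;> simp [stepSign] at h2 ⊢
      rw [this]

/-- Every checker path from the origin through `(ε, ε)` is encoded by some list. -/
theorem exists_pathOf_eq {ε : ℝ} (hε : 0 < ε) (l : List (ℝ × ℝ)) (hl : IsCheckerPath ε l)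
    (h0 : l.head? = some (0, 0)) (h1 : (ε, ε) ∈ l) : ∃ s, pathOf ε s = l := by
  induction l using List.reverseRecOn with
  | nil => simp at h1
  | append_singleton l q ih =>
    obtain ⟨hc, -, hq⟩ := List.isChain_append.1 hl.2
    have hl' : IsCheckerPath ε l := ⟨fun p hp => hl.1 p (by simp [hp]), hc⟩
    have hne : l ≠ [] := by
      rintro rfl
      simp only [List.nil_append, List.mem_singleton, List.head?_cons, Option.some.injEq] at h0 h1
      exact hε.ne' (congrArg Prod.fst (h1.trans h0))
    have h0' : l.head? = some (0, 0) := by rwa [List.head?_append_of_ne_nil _ hne] at h0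
    by_cases hm : (ε, ε) ∈ l
    · obtain ⟨s, rfl⟩ := ih hl' h0' hm
      have hstep := hq _ (getLast?_pathOf ε s) q (by simp)
      rcases hstep with h | h
      · refine ⟨true :: s, ?_⟩
        rw [sub_eq_iff_eq_add] at h
        simp only [pathOf, pathEnd, stepSign, h]
        congr 2
        ext <;> simp <;> ring
      · refine ⟨false :: s, ?_⟩
        rw [sub_eq_iff_eq_add] at h
        simp only [pathOf, pathEnd, stepSign, h]
        congr 2
        ext <;> simp <;> ring
    · -- Time strictly increases along the path, hence `(ε, ε)` can only be the second point.
      have hqe : q = (ε, ε) := by simpa [hm, eq_comm] using h1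
      refine ⟨[], ?_⟩
      obtain ⟨l, p, rfl⟩ : ∃ l' p, l = l' ++ [p] := by
        simpa using (List.eq_nil_or_concat l).resolve_left hne
      have hp2 : p.2 = 0 := by
        rcases hq p (by simp) q (by simp) with h | h <;>
        · have := congrArg Prod.snd h
          rw [hqe] at this
          simpa using this
      have hlt : (l ++ [p]).Pairwise fun a b => a.2 < b.2 := by
        have : IsTrans (ℝ × ℝ) fun a b => a.2 < b.2 := ⟨fun _ _ _ => lt_trans⟩
        refine List.IsChain.pairwise (hc.imp fun a b h => ?_)
        rcases h with h | h <;>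
        · have := congrArg Prod.snd h
          simp only [Prod.snd_sub] at this
          linarith
      cases l with
      | nil =>
        simp only [List.nil_append, List.head?_cons, Option.some.injEq] at h0'
        simp [pathOf, h0', hqe]
      | cons a l =>
        have ha : a = (0, 0) := by simpa using h0'
        have := (List.pairwise_cons.1 hlt).1 p (by simp)
        rw [ha, hp2] at this
        exact absurd this (lt_irrefl _)

/-- The direction lists of length `n` encoding paths with the given endpoint and last direction. -/
def dirLists (n : ℕ) (X : ℤ) (b : Bool) : Set (List Bool) :=
  {s | s.length = n ∧ pathEnd s = X ∧ lastDir s = b}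

theorem finite_dirLists (n : ℕ) (X : ℤ) (b : Bool) : (dirLists n X b).Finite :=
  (List.finite_length_eq Bool n).subset fun _ h => h.1

theorem disjoint_dirLists (n : ℕ) (X : ℤ) : Disjoint (dirLists n X true) (dirLists n X false) := by
  rw [Set.disjoint_left]
  rintro s ⟨-, -, h⟩ ⟨-, -, h'⟩
  simp [h] at h'

theorem dirLists_succ (n : ℕ) (X : ℤ) (b : Bool) : dirLists (n + 1) X b =
    List.cons b '' (dirLists n (X - stepSign b) true ∪ dirLists n (X - stepSign b) false) := by
  ext s
  constructor
  · rintro ⟨h1, h2, h3⟩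
    cases s with
    | nil => simp at h1
    | cons b' s =>
      obtain rfl : b' = b := h3
      have h4 : pathEnd s = X - stepSign b' := by rw [← h2, pathEnd]; ring
      have h5 : s.length = n := by simpa using h1
      refine ⟨s, ?_, rfl⟩
      cases hb : lastDir s
      · exact .inr ⟨h5, h4, hb⟩
      · exact .inl ⟨h5, h4, hb⟩
  · rintro ⟨s, h | h, rfl⟩ <;> exact ⟨by simp [h.1], by simp [pathEnd, h.2.1], rfl⟩

theorem checkerPaths_eq {ε : ℝ} (hε : 0 < ε) (X : ℤ) (n : ℕ) :
    checkerPaths (ε * X) (ε * (n + 1)) ε =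
      pathOf ε '' (dirLists n X true ∪ dirLists n X false) := by
  ext l
  constructor
  · rintro ⟨hl, h0, hlast, hm⟩
    obtain ⟨s, rfl⟩ := exists_pathOf_eq hε l hl h0 hm
    rw [getLast?_pathOf] at hlast
    simp only [Option.some.injEq, Prod.mk.injEq, mul_eq_mul_left_iff, hε.ne', or_false,
      Int.cast_inj, add_left_inj, Nat.cast_inj] at hlast
    refine ⟨s, ?_, rfl⟩
    cases hb : lastDir s
    · exact .inr ⟨hlast.2, hlast.1, hb⟩
    · exact .inl ⟨hlast.2, hlast.1, hb⟩
  · rintro ⟨s, h | h, rfl⟩ <;>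
    · refine ⟨isCheckerPath_pathOf ε s, head?_pathOf ε s, ?_, mem_pathOf ε s⟩
      rw [getLast?_pathOf, h.1, h.2.1]

theorem turns_append (l : List (ℝ × ℝ)) (p q r : ℝ × ℝ) :
    turns (l ++ [p, q, r]) = turns (l ++ [p, q]) +
      if (r - q).1 * (p - q).1 + (r - q).2 * (p - q).2 = 0 then 1 else 0 := by
  induction l with
  | nil => simp [turns]
  | cons a l ih =>
    rcases l with _ | ⟨b, _ | ⟨d, l⟩⟩
    · simp [turns]
    · simp only [List.cons_append, List.nil_append, turns] at ih ⊢
      omega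
    · simp only [List.cons_append, turns] at ih ⊢
      omega

theorem turns_pathOf_cons {ε : ℝ} (hε : ε ≠ 0) (b : Bool) (s : List Bool) :
    turns (pathOf ε (b :: s)) = turns (pathOf ε s) + if b = lastDir s then 0 else 1 := by
  obtain ⟨l, hl⟩ := pathOf_eq_append ε s
  have h := turns_append l (ε * (pathEnd s - stepSign (lastDir s)), ε * s.length)
    (ε * pathEnd s, ε * (s.length + 1)) (ε * pathEnd (b :: s), ε * ((s.length + 1 : ℕ) + 1))
  rw [pathOf, hl, List.append_assoc, List.cons_append, List.cons_append, List.nil_append, h]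
  congr 1
  have h2 : (ε * pathEnd (b :: s) - ε * pathEnd s) *
      (ε * (pathEnd s - stepSign (lastDir s)) - ε * pathEnd s) +
      (ε * (((s.length + 1 : ℕ) : ℝ) + 1) - ε * (s.length + 1)) *
      (ε * s.length - ε * (s.length + 1)) =
      -ε ^ 2 * (1 + stepSign b * stepSign (lastDir s)) := by
    simp only [pathEnd]
    push_cast
    ring
  simp only [Prod.fst_sub, Prod.snd_sub, h2]
  cases b <;> cases lastDir s <;> simp [stepSign, hε]

theorem pathWeight_pathOf_nil (m ε : ℝ) : pathWeight m ε (pathOf ε []) = Complex.I := by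
  simp [pathWeight, pathOf, turns]

theorem pathWeight_pathOf_cons (m : ℝ) {ε : ℝ} (hε : ε ≠ 0) (b : Bool) (s : List Bool) :
    pathWeight m ε (pathOf ε (b :: s)) = (1 / √(1 + m ^ 2 * ε ^ 2) : ℝ) *
      (if b = lastDir s then 1 else -Complex.I * (m * ε : ℝ)) * pathWeight m ε (pathOf ε s) := by
  have h : (0 : ℝ) < 1 + m ^ 2 * ε ^ 2 := by positivity
  have h1 : (1 + m ^ 2 * ε ^ 2) ^ (1 - (((pathOf ε (b :: s)).length : ℕ) : ℝ) / 2) =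
      1 / √(1 + m ^ 2 * ε ^ 2) *
        (1 + m ^ 2 * ε ^ 2) ^ (1 - (((pathOf ε s).length : ℕ) : ℝ) / 2) := by
    rw [Real.sqrt_eq_rpow, one_div, ← Real.rpow_neg h.le, ← Real.rpow_add h, length_pathOf,
      length_pathOf, List.length_cons]
    congr 1
    push_cast
    ring
  rw [pathWeight, pathWeight, h1, turns_pathOf_cons hε]
  push_cast
  split_ifs
  · ring
  · ring

theorem finsum_dirLists_succ (m : ℝ) {ε : ℝ} (hε : ε ≠ 0) (n : ℕ) (X : ℤ) (b : Bool) :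
    ∑ᶠ s ∈ dirLists (n + 1) X b, pathWeight m ε (pathOf ε s) =
      (1 / √(1 + m ^ 2 * ε ^ 2) : ℝ) *
        (∑ᶠ s ∈ dirLists n (X - stepSign b) b, pathWeight m ε (pathOf ε s) -
          Complex.I * (m * ε : ℝ) *
            ∑ᶠ s ∈ dirLists n (X - stepSign b) (!b), pathWeight m ε (pathOf ε s)) := by
  rw [dirLists_succ, finsum_mem_image (List.cons_injective.injOn),
    finsum_mem_union (disjoint_dirLists _ _) (finite_dirLists _ _ _) (finite_dirLists _ _ _)]
  have key (b' : Bool) : ∑ᶠ s ∈ dirLists n (X - stepSign b) b', pathWeight m ε (pathOf ε (b :: s)) =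
      (1 / √(1 + m ^ 2 * ε ^ 2) : ℝ) * (if b = b' then 1 else -Complex.I * (m * ε : ℝ)) *
        ∑ᶠ s ∈ dirLists n (X - stepSign b) b', pathWeight m ε (pathOf ε s) := by
    refine .trans (finsum_mem_congr rfl fun s hs => ?_)
      (mul_finsum_mem _ _).symm
    rw [pathWeight_pathOf_cons m hε, hs.2.2]
  rw [key, key]
  cases b <;> simp <;> ring

/-- Paths ending with a step to the right have an even number of turns and contribute to the
imaginary part of the amplitude; the other ones contribute to the real part. -/
theorem finsum_dirLists (m : ℝ) {ε : ℝ} (hε : ε ≠ 0) (n : ℕ) : ∀ X : ℤ,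
    (∑ᶠ s ∈ dirLists n X true, pathWeight m ε (pathOf ε s) = Complex.I *
      ((latticeAmplitude (1 / √(1 + m ^ 2 * ε ^ 2)) (m * ε) n X).2 : ℝ)) ∧
    (∑ᶠ s ∈ dirLists n X false, pathWeight m ε (pathOf ε s) =
      ((latticeAmplitude (1 / √(1 + m ^ 2 * ε ^ 2)) (m * ε) n X).1 : ℝ)) := by
  induction n with
  | zero =>
    intro X
    constructor
    · by_cases hX : X = 1
      · have : dirLists 0 X true = {[]} := by
          ext s
          simp only [dirLists, List.length_eq_zero_iff, Set.mem_ofPred_eq, Set.mem_singleton_iff]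
          refine ⟨fun h => h.1, ?_⟩
          rintro rfl
          exact ⟨rfl, hX.symm, rfl⟩
        rw [this, finsum_mem_singleton, pathWeight_pathOf_nil]
        simp [latticeAmplitude, hX]
      · have : dirLists 0 X true = ∅ := by
          ext s
          simp only [dirLists, List.length_eq_zero_iff, Set.mem_ofPred_eq, Set.mem_empty_iff_false,
            iff_false]
          rintro ⟨rfl, h, -⟩
          exact hX h.symm
        rw [this, finsum_mem_empty]
        simp [latticeAmplitude, hX]
    · have : dirLists 0 X false = ∅ := by
        ext s
        simp only [dirLists, List.length_eq_zero_iff, Set.mem_ofPred_eq, Set.mem_empty_iff_false,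
          iff_false]
        rintro ⟨rfl, -, h⟩
        simp [lastDir] at h
      rw [this, finsum_mem_empty]
      simp [latticeAmplitude]
  | succ n ih =>
    intro X
    have hI := Complex.I_sq
    have ht : X - stepSign true = X - 1 := rfl
    have hf : X - stepSign false = X + 1 := sub_neg_eq_add X 1
    rw [finsum_dirLists_succ m hε, finsum_dirLists_succ m hε, ht, hf, Bool.not_true, Bool.not_false,
      (ih _).1, (ih _).2, (ih _).1, (ih _).2, latticeAmplitude]
    generalize 1 / √(1 + m ^ 2 * ε ^ 2) = c at *
    constructor
    · push_cast
      ring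
    · push_cast
      linear_combination (-c * (m * ε) * (latticeAmplitude c (m * ε) n (X + 1)).2 : ℂ) * hI

theorem checkerAmplitude_eq (m : ℝ) {ε : ℝ} (hε : 0 < ε) (n : ℕ) (X : ℤ) :
    checkerAmplitude₁ (ε * X) (ε * (n + 1)) m ε =
      (latticeAmplitude (1 / √(1 + m ^ 2 * ε ^ 2)) (m * ε) n X).1 ∧
    checkerAmplitude₂ (ε * X) (ε * (n + 1)) m ε =
      (latticeAmplitude (1 / √(1 + m ^ 2 * ε ^ 2)) (m * ε) n X).2 := by
  rw [checkerAmplitude₁, checkerAmplitude₂, checkerAmplitude, checkerPaths_eq hε,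
    finsum_mem_image (pathOf_injective hε.ne').injOn,
    finsum_mem_union (disjoint_dirLists _ _) (finite_dirLists _ _ _) (finite_dirLists _ _ _),
    (finsum_dirLists m hε.ne' n X).1, (finsum_dirLists m hε.ne' n X).2]
  simp

/-! ### Integer coordinates on the lattice -/

/-- The point of `εℤ²` with the integer coordinates `X` and `T`. -/
def latticePoint (ε : ℝ) (X T : ℤ) : squareLattice ε :=
  ⟨(ε * X, ε * T), mem_squareLattice_mul ε X T⟩

section Lattice

variable {ε : ℝ}

theorem latticePoint_bijective (hε : ε ≠ 0) :
    Function.Bijective fun q : ℤ × ℤ => latticePoint ε q.1 q.2 := by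
  constructor
  · rintro ⟨X, T⟩ ⟨X', T'⟩ h
    simpa [latticePoint, hε] using h
  · rintro ⟨p, hp⟩
    obtain ⟨⟨X, hX⟩, T, hT⟩ := id hp
    rw [div_eq_iff hε, mul_comm] at hX hT
    exact ⟨(X, T), Subtype.ext (Prod.ext hX.symm hT.symm)⟩

/-- The point `latticePoint ε X T` as a point of the doubled lattice. -/
abbrev evenPoint (ε : ℝ) (X T : ℤ) : doubledLattice ε := latticeIncl (latticePoint ε X T)

theorem isEvenPoint_evenPoint (hε : ε ≠ 0) (X T : ℤ) : IsEvenPoint ε (evenPoint ε X T).1 := by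
  refine ⟨⟨2 * X, even_two_mul X, ?_⟩, 2 * T, even_two_mul T, ?_⟩ <;>
  · simp only [latticeIncl, latticePoint]
    field_simp
    push_cast
    rfl

theorem exists_eq_evenPoint (hε : ε ≠ 0) {P : doubledLattice ε} (hP : IsEvenPoint ε P.1) :
    ∃ X T, P = evenPoint ε X T := by
  obtain ⟨⟨a, ⟨X, rfl⟩, hX⟩, b, ⟨T, rfl⟩, hT⟩ := hP
  refine ⟨X, T, Subtype.ext (Prod.ext ?_ ?_)⟩
  · simp only [latticeIncl, latticePoint]
    field_simp at hX
    push_cast at hX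
    linarith
  · simp only [latticeIncl, latticePoint]
    field_simp at hT
    push_cast at hT
    linarith

theorem isEvenPoint_or_isOddPoint (P : doubledLattice ε) : IsEvenPoint ε P.1 ∨ IsOddPoint ε P.1 := by
  obtain ⟨⟨x, t⟩, ⟨a, ha⟩, ⟨b, hb⟩, c, hc⟩ := P
  have hsum : a + b = 2 * c := by
    have : (a + b : ℝ) = 2 * c := by rw [← ha, ← hb, ← hc]; ring
    exact_mod_cast this
  rcases Int.even_or_odd a with h | h
  · exact .inl ⟨⟨a, h, ha⟩, b, by grind, hb⟩
  · exact .inr ⟨⟨a, h, ha⟩, b, by grind, hb⟩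

theorem IsOddPoint.not_isEvenPoint {p : ℝ × ℝ} (h : IsOddPoint ε p) : ¬ IsEvenPoint ε p := by
  rintro ⟨⟨a, ha, ha'⟩, -⟩
  obtain ⟨⟨b, hb, hb'⟩, -⟩ := h
  obtain rfl : a = b := by exact_mod_cast ha'.symm.trans hb'
  exact Int.not_even_iff_odd.2 hb ha

theorem isOddPoint_rightDown (hε : ε ≠ 0) (X T : ℤ) :
    IsOddPoint ε (rightDown (evenPoint ε X T)).1 := by
  refine ⟨⟨2 * X + 1, odd_two_mul_add_one X, ?_⟩, 2 * T - 1, (even_two_mul T).sub_odd odd_one, ?_⟩ <;>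
  · simp only [rightDown, latticeIncl, latticePoint]
    field_simp
    push_cast
    ring

theorem isOddPoint_leftDown (hε : ε ≠ 0) (X T : ℤ) :
    IsOddPoint ε (leftDown (evenPoint ε X T)).1 := by
  refine ⟨⟨2 * X - 1, (even_two_mul X).sub_odd odd_one, ?_⟩, 2 * T - 1,
    (even_two_mul T).sub_odd odd_one, ?_⟩ <;>
  · simp only [leftDown, latticeIncl, latticePoint]
    field_simp
    push_cast
    ring

theorem IsOddPoint.rightDown (hε : ε ≠ 0) {P : doubledLattice ε} (h : IsOddPoint ε P.1) :
    IsEvenPoint ε (rightDown P).1 := by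
  obtain ⟨⟨a, ha, ha'⟩, b, hb, hb'⟩ := h
  refine ⟨⟨a + 1, ha.add_odd odd_one, ?_⟩, b - 1, hb.sub_odd odd_one, ?_⟩
  · push_cast
    rw [← ha', _root_.rightDown]
    field_simp
  · push_cast
    rw [← hb', _root_.rightDown]
    field_simp

theorem IsOddPoint.leftDown (hε : ε ≠ 0) {P : doubledLattice ε} (h : IsOddPoint ε P.1) :
    IsEvenPoint ε (leftDown P).1 := by
  obtain ⟨⟨a, ha, ha'⟩, b, hb, hb'⟩ := h
  refine ⟨⟨a - 1, ha.sub_odd odd_one, ?_⟩, b - 1, hb.sub_odd odd_one, ?_⟩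
  · push_cast
    rw [← ha', _root_.leftDown]
    field_simp
  · push_cast
    rw [← hb', _root_.leftDown]
    field_simp

theorem rightDown_rightDown (X T : ℤ) :
    rightDown (rightDown (evenPoint ε X T)) = evenPoint ε (X + 1) (T - 1) := by
  refine Subtype.ext (Prod.ext ?_ ?_) <;> simp only [rightDown, latticeIncl, latticePoint] <;>
    push_cast <;> ring

theorem leftDown_rightDown (X T : ℤ) :
    leftDown (rightDown (evenPoint ε X T)) = evenPoint ε X (T - 1) := by
  refine Subtype.ext (Prod.ext ?_ ?_) <;>
    simp only [rightDown, leftDown, latticeIncl, latticePoint] <;> push_cast <;> ring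

theorem rightDown_leftDown (X T : ℤ) :
    rightDown (leftDown (evenPoint ε X T)) = evenPoint ε X (T - 1) := by
  refine Subtype.ext (Prod.ext ?_ ?_) <;>
    simp only [rightDown, leftDown, latticeIncl, latticePoint] <;> push_cast <;> ring

theorem leftDown_leftDown (X T : ℤ) :
    leftDown (leftDown (evenPoint ε X T)) = evenPoint ε (X - 1) (T - 1) := by
  refine Subtype.ext (Prod.ext ?_ ?_) <;> simp only [leftDown, latticeIncl, latticePoint] <;>
    push_cast <;> ring

theorem evenPoint_eq_zero_iff (hε : ε ≠ 0) (X T : ℤ) :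
    (evenPoint ε X T).1 = (0, 0) ↔ X = 0 ∧ T = 0 := by
  simp [latticeIncl, latticePoint, hε]

/-! ### From the axioms to the propagator and back -/

variable {m δ : ℝ}

theorem summable_latticePoint_iff (hε : ε ≠ 0) {f : squareLattice ε → ℝ} :
    (Summable fun q : ℤ × ℤ => f (latticePoint ε q.1 q.2)) ↔ Summable f :=
  (Equiv.ofBijective _ (latticePoint_bijective hε)).summable_iff (f := f)

/-- The first axiom with the values at odd points expressed by the second axiom. -/
theorem SatisfiesAxioms.isPropagator (hε : ε ≠ 0) {A₁ A₂ : doubledLattice ε → ℂ}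
    (h : SatisfiesAxioms ε m δ A₁ A₂) :
    IsPropagator (1 / √(1 + m ^ 2 * ε ^ 2) * (1 / √(1 - δ ^ 2))) (m * ε) δ
      (fun X T => A₁ (evenPoint ε X T)) fun X T => A₂ (evenPoint ε X T) where
  fst_eq X T := by
    rw [h.axiom1_fst _ (isEvenPoint_evenPoint hε X T),
      h.axiom2_fst _ (isOddPoint_rightDown hε X T), h.axiom2_snd _ (isOddPoint_rightDown hε X T),
      rightDown_rightDown, leftDown_rightDown]
    push_cast
    ring
  snd_eq X T := by
    rw [h.axiom1_snd _ (isEvenPoint_evenPoint hε X T),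
      h.axiom2_fst _ (isOddPoint_leftDown hε X T), h.axiom2_snd _ (isOddPoint_leftDown hε X T),
      rightDown_leftDown, leftDown_leftDown]
    simp only [evenPoint_eq_zero_iff hε]
    push_cast
    ring
  summable := (summable_latticePoint_iff hε).2 h.axiom3

open Classical in
/-- The first component of the extension of a pair of functions of the integer coordinates to the
doubled lattice by means of the second axiom. -/
def extendFst (ε δ : ℝ) (E₁ E₂ : doubledLattice ε → ℂ) (P : doubledLattice ε) : ℂ :=
  if IsEvenPoint ε P.1 then E₁ P else
    (1 / √(1 - δ ^ 2) : ℝ) * (E₁ (rightDown P) - Complex.I * δ * E₂ (rightDown P))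

open Classical in
/-- The second component of the extension; see `extendFst`. -/
def extendSnd (ε δ : ℝ) (E₁ E₂ : doubledLattice ε → ℂ) (P : doubledLattice ε) : ℂ :=
  if IsEvenPoint ε P.1 then E₂ P else
    (1 / √(1 - δ ^ 2) : ℝ) * (E₂ (leftDown P) + Complex.I * δ * E₁ (leftDown P))

/-- A function of the integer coordinates as a function on the doubled lattice; the values at odd
points are irrelevant. -/
def ofCoords (ε : ℝ) (B : ℤ → ℤ → ℂ) (P : doubledLattice ε) : ℂ :=
  B (round (P.1.1 / ε)) (round (P.1.2 / ε))

theorem ofCoords_evenPoint (hε : ε ≠ 0) (B : ℤ → ℤ → ℂ) (X T : ℤ) :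
    ofCoords ε B (evenPoint ε X T) = B X T := by
  simp [ofCoords, latticeIncl, latticePoint, hε]

theorem IsPropagator.satisfiesAxioms (hε : ε ≠ 0) {B₁ B₂ : ℤ → ℤ → ℂ}
    (h : IsPropagator (1 / √(1 + m ^ 2 * ε ^ 2) * (1 / √(1 - δ ^ 2))) (m * ε) δ B₁ B₂) :
    SatisfiesAxioms ε m δ (extendFst ε δ (ofCoords ε B₁) (ofCoords ε B₂))
      (extendSnd ε δ (ofCoords ε B₁) (ofCoords ε B₂)) where
  axiom1_fst P hP := by
    obtain ⟨X, T, rfl⟩ := exists_eq_evenPoint hε hP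
    have hodd := (isOddPoint_rightDown hε X T).not_isEvenPoint
    simp only [extendFst, extendSnd, if_pos hP, if_neg hodd, rightDown_rightDown,
      leftDown_rightDown, ofCoords_evenPoint hε]
    rw [h.fst_eq X T]
    push_cast
    ring
  axiom1_snd P hP := by
    obtain ⟨X, T, rfl⟩ := exists_eq_evenPoint hε hP
    have hodd := (isOddPoint_leftDown hε X T).not_isEvenPoint
    simp only [extendFst, extendSnd, if_pos hP, if_neg hodd, rightDown_leftDown,
      leftDown_leftDown, ofCoords_evenPoint hε, evenPoint_eq_zero_iff hε]
    rw [h.snd_eq X T]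
    push_cast
    ring
  axiom2_fst P hP := by
    simp only [extendFst, extendSnd, if_neg hP.not_isEvenPoint, if_pos (hP.rightDown hε)]
  axiom2_snd P hP := by
    simp only [extendFst, extendSnd, if_neg hP.not_isEvenPoint, if_pos (hP.leftDown hε)]
  axiom3 := by
    rw [← summable_latticePoint_iff hε]
    simp only [extendFst, extendSnd, if_pos (isEvenPoint_evenPoint hε _ _), ofCoords_evenPoint hε]
    exact h.summable

theorem normalization_pos (hδ0 : 0 < δ) (hδ1 : δ < 1) :
    0 < 1 / √(1 + m ^ 2 * ε ^ 2) * (1 / √(1 - δ ^ 2)) := by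
  have h1 : 0 < 1 + m ^ 2 * ε ^ 2 := by positivity
  have h2 : 0 < 1 - δ ^ 2 := by nlinarith
  have := Real.sqrt_pos.2 h1
  have := Real.sqrt_pos.2 h2
  positivity

theorem normalization_sq (hδ0 : 0 < δ) (hδ1 : δ < 1) :
    (1 / √(1 + m ^ 2 * ε ^ 2) * (1 / √(1 - δ ^ 2))) ^ 2 * (1 + (m * ε) ^ 2) * (1 - δ ^ 2) = 1 := by
  have h1 : 0 < 1 + m ^ 2 * ε ^ 2 := by positivity
  have h2 : 0 < 1 - δ ^ 2 := by nlinarith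
  rw [mul_pow, div_pow, div_pow, Real.sq_sqrt h1.le, Real.sq_sqrt h2.le, mul_pow]
  field_simp

theorem SatisfiesAxioms.unique (hε : 0 < ε) (hm : 0 < m) (hδ0 : 0 < δ) (hδ1 : δ < 1)
    {A₁ A₂ A₁' A₂' : doubledLattice ε → ℂ} (h : SatisfiesAxioms ε m δ A₁ A₂)
    (h' : SatisfiesAxioms ε m δ A₁' A₂') : A₁ = A₁' ∧ A₂ = A₂' := by
  obtain ⟨h₁, h₂⟩ := (h.isPropagator hε.ne').unique (normalization_sq hδ0 hδ1)
    (by positivity) (h'.isPropagator hε.ne')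
  have e₁ {P : doubledLattice ε} (hP : IsEvenPoint ε P.1) : A₁ P = A₁' P := by
    obtain ⟨X, T, rfl⟩ := exists_eq_evenPoint hε.ne' hP
    exact congrFun (congrFun h₁ X) T
  have e₂ {P : doubledLattice ε} (hP : IsEvenPoint ε P.1) : A₂ P = A₂' P := by
    obtain ⟨X, T, rfl⟩ := exists_eq_evenPoint hε.ne' hP
    exact congrFun (congrFun h₂ X) T
  refine ⟨funext fun P => ?_, funext fun P => ?_⟩ <;>
    rcases isEvenPoint_or_isOddPoint P with hP | hP
  · exact e₁ hP
  · rw [h.axiom2_fst P hP, h'.axiom2_fst P hP, e₁ (hP.rightDown hε.ne'), e₂ (hP.rightDown hε.ne')]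
  · exact e₂ hP
  · rw [h.axiom2_snd P hP, h'.axiom2_snd P hP, e₁ (hP.leftDown hε.ne'), e₂ (hP.leftDown hε.ne')]

theorem existsUnique_satisfiesAxioms (hε : 0 < ε) (hm : 0 < m) (hδ0 : 0 < δ) (hδ1 : δ < 1) :
    ∃! A : (doubledLattice ε → ℂ) × (doubledLattice ε → ℂ), SatisfiesAxioms ε m δ A.1 A.2 := by
  refine ⟨(_, _), (isPropagator_coeffFunctional_symbol (normalization_sq hδ0 hδ1)
    (normalization_pos hδ0 hδ1) (by positivity)).satisfiesAxioms hε.ne', fun A hA => ?_⟩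
  obtain ⟨h₁, h₂⟩ := hA.unique hε hm hδ0 hδ1 ((isPropagator_coeffFunctional_symbol
    (normalization_sq hδ0 hδ1) (normalization_pos hδ0 hδ1) (by positivity)).satisfiesAxioms hε.ne')
  exact Prod.ext h₁ h₂

/-! ### The limit of vanishing imaginary mass -/

/-- The limits at a point of `εℤ²`, with the lattice amplitudes expressed as sums over paths. -/
theorem exists_limit_evenPoint (hε : 0 < ε) (hm : 0 < m) {A₁ A₂ : ℝ → doubledLattice ε → ℂ}
    (hA : ∀ δ : ℝ, 0 < δ → δ < 1 → SatisfiesAxioms ε m δ (A₁ δ) (A₂ δ)) (X T : ℤ) :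
    ∃ l₁ l₂ : ℂ, Tendsto (fun δ => A₁ δ (evenPoint ε X T)) (𝓝[>] 0) (𝓝 l₁) ∧
      Tendsto (fun δ => A₂ δ (evenPoint ε X T)) (𝓝[>] 0) (𝓝 l₂) ∧
      (Odd (X + T) → l₁ = checkerAmplitude₁ (ε * X) (|ε * T| + ε) m ε) ∧
      (Even (X + T) → 0 ≤ ε * T → l₂ = checkerAmplitude₂ (ε * X + ε) (|ε * T| + ε) m ε) ∧
      (Even (X + T) → ε * T < 0 → l₂ = -checkerAmplitude₂ (-(ε * X) + ε) (|ε * T| + ε) m ε) ∧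
      (Even (X + T) → l₁.re = 0) ∧ (Odd (X + T) → l₂.re = 0) := by
  set c : ℝ := 1 / √(1 + m ^ 2 * ε ^ 2) with hc
  have hcsq : c ^ 2 * (1 + (m * ε) ^ 2) = 1 := by
    have h1 : 0 < 1 + m ^ 2 * ε ^ 2 := by positivity
    rw [hc, div_pow, Real.sq_sqrt h1.le, mul_pow]
    field_simp
  have hμ : 0 < m * ε := by positivity
  have hc1 : c ^ 2 < 1 := by
    have : 0 < c ^ 2 := by rw [hc]; positivity
    nlinarith [mul_pos this (pow_pos hμ 2)]
  have hκc : Tendsto (fun δ : ℝ => c * (1 / √(1 - δ ^ 2))) (𝓝[>] 0) (𝓝 c) := by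
    have h : ContinuousAt (fun δ : ℝ => c * (1 / √(1 - δ ^ 2))) 0 := by
      refine continuousAt_const.mul (continuousAt_const.div (by fun_prop) (by simp))
    simpa using h.tendsto.mono_left nhdsWithin_le_nhds
  have hB := fun δ h0 h1 => (hA δ h0 h1).isPropagator hε.ne'
  rcases le_or_gt 0 T with hT | hT
  · obtain ⟨n, rfl⟩ := Int.eq_ofNat_of_zero_le hT
    obtain ⟨l₁, l₂, h₁, h₂, ho, he⟩ := tendsto_propagator_natCast hc1 hμ
      (fun δ h0 h1 => normalization_pos h0 h1) (fun δ h0 h1 => normalization_sq h0 h1) hκc hB n X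
    have ht : |ε * ((n : ℤ) : ℝ)| + ε = ε * (n + 1) := by
      rw [abs_of_nonneg (by positivity)]; push_cast; ring
    have hx : ε * (X : ℝ) + ε = ε * (X + 1 : ℤ) := by push_cast; ring
    refine ⟨l₁, l₂, h₁, h₂, fun h => ?_, fun h _ => ?_, fun _ h => ?_, fun h => (he h).2,
      fun h => (ho h).2⟩
    · rw [ht, (checkerAmplitude_eq m hε n X).1, (ho h).1]
    · rw [ht, hx, (checkerAmplitude_eq m hε n (X + 1)).2, (he h).1]
    · exact absurd h (not_lt.2 (by positivity))
  · obtain ⟨n, rfl⟩ : ∃ n : ℕ, T = -n := ⟨T.natAbs, by omega⟩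
    obtain ⟨l₁, l₂, h₁, h₂, ho, he⟩ := tendsto_propagator_neg_natCast hc1 hμ
      (fun δ h0 h1 => normalization_pos h0 h1) (fun δ h0 h1 => normalization_sq h0 h1) hκc hB n X
    have hn : (0 : ℝ) < n := by
      have : 0 < n := by omega
      exact_mod_cast this
    have ht : |ε * ((-n : ℤ) : ℝ)| + ε = ε * (n + 1) := by
      push_cast
      rw [mul_neg, abs_neg, abs_of_nonneg (by positivity)]
      ring
    have hx : -(ε * (X : ℝ)) + ε = ε * (-X + 1 : ℤ) := by push_cast; ring
    simp only [hT.ne, and_false, if_false, sub_zero] at h₂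
    refine ⟨l₁, l₂, h₁, h₂, fun h => ?_, fun _ h => ?_, fun h _ => ?_, fun h => (he ?_).2,
      fun h => (ho ?_).2⟩
    · rw [ht, (checkerAmplitude_eq m hε n X).1, (ho (by grind)).1,
        (latticeAmplitude_fst_neg hcsq n).1]
    · refine absurd h (not_le.2 ?_)
      push_cast
      nlinarith
    · rw [ht, hx, (checkerAmplitude_eq m hε n (-X + 1)).2, (he (by grind)).1]
    · grind
    · grind

end Lattice

end

theorem mainTheorem1 (ε m : ℝ) (hε : 0 < ε) (hm : 0 < m) :
    (∀ δ : ℝ, 0 < δ → δ < 1 →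
      ∃! A : (doubledLattice ε → ℂ) × (doubledLattice ε → ℂ),
        SatisfiesAxioms ε m δ A.1 A.2) ∧
    ∀ A₁ A₂ : ℝ → doubledLattice ε → ℂ,
      (∀ δ : ℝ, 0 < δ → δ < 1 → SatisfiesAxioms ε m δ (A₁ δ) (A₂ δ)) →
      ∃ L₁ L₂ : squareLattice ε → ℂ,
        (∀ P : squareLattice ε,
          Tendsto (fun δ => A₁ δ (latticeIncl P)) (𝓝[>] 0) (𝓝 (L₁ P)) ∧
          Tendsto (fun δ => A₂ δ (latticeIncl P)) (𝓝[>] 0) (𝓝 (L₂ P))) ∧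
        ∀ (x t : ℝ) (h : (x, t) ∈ squareLattice ε) (n : ℤ), (x + t) / ε = n →
          (Odd n → L₁ ⟨(x, t), h⟩ = (checkerAmplitude₁ x (|t| + ε) m ε : ℂ)) ∧
          (Even n → 0 ≤ t → L₂ ⟨(x, t), h⟩ = (checkerAmplitude₂ (x + ε) (|t| + ε) m ε : ℂ)) ∧
          (Even n → t < 0 → L₂ ⟨(x, t), h⟩ = -(checkerAmplitude₂ (-x + ε) (|t| + ε) m ε : ℂ)) ∧
          (Even n → (L₁ ⟨(x, t), h⟩).re = 0) ∧
          (Odd n → (L₂ ⟨(x, t), h⟩).re = 0) := by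
  refine ⟨fun δ h0 h1 => existsUnique_satisfiesAxioms hε hm h0 h1, fun A₁ A₂ hA => ?_⟩
  choose l₁ l₂ h₁ h₂ hl using exists_limit_evenPoint hε hm hA
  obtain ⟨e, he⟩ : ∃ e : squareLattice ε → ℤ × ℤ, ∀ P, latticePoint ε (e P).1 (e P).2 = P :=
    ⟨_, Function.surjInv_eq (latticePoint_bijective hε.ne').2⟩
  refine ⟨fun P => l₁ (e P).1 (e P).2, fun P => l₂ (e P).1 (e P).2, fun P => ?_, ?_⟩
  · have h := h₁ (e P).1 (e P).2
    have h' := h₂ (e P).1 (e P).2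
    rw [evenPoint, he] at h h'
    exact ⟨h, h'⟩
  · intro x t h n hn
    have hP := congrArg Subtype.val (he ⟨(x, t), h⟩)
    have hX : ε * (e ⟨(x, t), h⟩).1 = x := congrArg Prod.fst hP
    have hT : ε * (e ⟨(x, t), h⟩).2 = t := congrArg Prod.snd hP
    have hl' := hl (e ⟨(x, t), h⟩).1 (e ⟨(x, t), h⟩).2
    have hsum : (e ⟨(x, t), h⟩).1 + (e ⟨(x, t), h⟩).2 = n := by
      have hxt : x + t = ε * ((e ⟨(x, t), h⟩).1 + (e ⟨(x, t), h⟩).2) := by rw [mul_add, hX, hT]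
      rw [hxt, mul_div_cancel_left₀ _ hε.ne'] at hn
      exact_mod_cast hn
    rw [hX, hT, hsum] at hl'
    exact hl'
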